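/- Let $\mathbb K=\mathbb R$ or $\mathbb C$, let $n\ge 1$, and let $X=\sum_j X_j\,\partial/\partial x_j$, $X_j\in\mathbb K[[x_1,\dots,x_n]]$, be a formal vector field on $(\mathbb K^n,0)$ with $X(0)=0$. Let $A\in\mathfrak{gl}_n(\mathbb K)$ be its Jacobian matrix at $0$ and $X^{(1)}=\sum_{j}\big(\sum_i A_{ji}x_i\big)\partial/\partial x_j$ its linear part. Let $\Omega=dx_1\wedge\dots\wedge dx_n$. A formal $p$-form $\eta$ is an infinitesimal deformation of an integrable formal $p$-form $\omega$ if $i_A\omega\wedge\eta+i_A\eta\wedge\omega=0$ and $i_A\omega\wedge d\eta+i_A\eta\wedge d\omega=0$ for every formal $(p-1)$-vector field $A$ (no condition if $p=0$). For a formal vector field $V$ with $V(0)=0$ let $\mathcal Z(V)$ be the space of formal vector fields $Y$ such that the $(n-1)$-form $i_Y\Omega$ is an infinitesimal deformation of $i_V\Omega$, let $\mathcal B(V)=\{\mathcal L_ZV : Z \text{ a formal vector field}\}$ and $\mathcal B(\mathcal F_V)=\{\mathcal L_ZV+fV : Z\text{ a formal vector field},\ f\in\mathbb K[[x_1,\dots,x_n]]\}$,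 and put $$DH(V)=\mathcal Z(V)/\mathcal B(V),\qquad DH(\mathcal F_V)=\mathcal Z(V)/\mathcal B(\mathcal F_V).$$ (The fields $Y$, $Z$ need not vanish at $0$.) Let $DH_{lin}(X^{(1)})$ be the space of linear vector fields in $\mathcal Z(X^{(1)})$ modulo the space of linear vector fields in $\mathcal B(X^{(1)})$. Suppose that $X^{(1)}$ is non-resonant: if $\lambda_1,\dots,\lambda_n$ are the eigenvalues of $A$ (in an algebraic closure of $\mathbb K$, with multiplicity), there is no relation $\lambda_j=\sum_i m_i\lambda_i$ with integers $m_i\ge0$ and $\sum_i m_i\ge2$. Then: (i) $DH(X)= DH_{lin}(X^{(1)})$, in the sense that the inclusion of the linear vector fields into the formal vector fields induces an isomorphism of vector spaces $DH_{lin}(X^{(1)})\to DH(X)$; the spaces $DH_{lin}(X^{(1)})$ and $DH(\mathcal F_X)$ are finite-dimensional, and $\dim DH(\mathcal F_X)=\dim DH_{lin}(X^{(1)})-1$. (ii) The adjoint orbit $\{gAg^{-1}: g\in GL_n(\mathbb K)\}$ is a smooth embedded submanifold of $\mathfrak{gl}_n(\mathbb K)$ (complex submanifold if $\mathbb K=\mathbb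 C$) and, $d$ being its dimension over $\mathbb K$, $\dim DH_{lin}(X^{(1)})=n^2-d\ge n$. (iii) If the eigenvalues $\lambda_1,\dots,\lambda_n$ are pairwise distinct, then $\dim DH_{lin}(X^{(1)})=n$. -/

import Mathlib

namespace DefCoh

open scoped Topology

noncomputable section

/-! ### Formal functions and formal vector fields on `(Kⁿ, 0)` -/

/-- Formal functions at the origin of `Kⁿ`: formal power series in `x₁, …, xₙ`. -/
abbrev Fun (K : Type*) [Field K] (n : ℕ) := MvPowerSeries (Fin n) K

/-- Formal vector fields: `X` stands for `∑ j, X j ∂/∂xⱼ`. -/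
abbrev VF (K : Type*) [Field K] (n : ℕ) := Fin n → Fun K n

/-- The components `ω (∂_{I 0}, …, ∂_{I (p-1)})` of a formal differential `p`-form `ω`
with respect to the coordinate vector fields. -/
abbrev FormComp (K : Type*) [Field K] (n p : ℕ) := (Fin p → Fin n) → Fun K n

variable {K : Type*} [Field K] {n : ℕ}

/-- The partial derivative `∂f/∂xᵢ`. -/
abbrev pd (i : Fin n) (f : Fun K n) : Fun K n := MvPowerSeries.pderiv K i f

/-- The Lie bracket `[Z, X] = ∑ j, (∑ i, Zᵢ ∂ᵢXⱼ - Xᵢ ∂ᵢZⱼ) ∂/∂xⱼ`,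
which is the Lie derivative `L_Z X`. -/
def bracket (Z X : VF K n) : VF K n :=
  fun j => ∑ i, (Z i * pd i (X j) - X i * pd i (Z j))

/-! ### Differential forms in components -/

/-- Exterior derivative:
`(dη)(∂_{I 0}, …, ∂_{I p}) = ∑ k, (-1)^k ∂_{I k} (η (∂_{I 0}, …, omit k, …, ∂_{I p}))`. -/
def extDer {p : ℕ} (η : FormComp K n p) : FormComp K n (p + 1) :=
  fun I => ∑ k : Fin (p + 1), (-1) ^ (k : ℕ) * pd (I k) (η fun l => I (k.succAbove l))

/-- Exterior product `α ∧ η` of a 1-form `α`, given by its components, with a `p`-form `η`. -/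
def wedge {p : ℕ} (α : Fin n → Fun K n) (η : FormComp K n p) : FormComp K n (p + 1) :=
  fun I => ∑ k : Fin (p + 1), (-1) ^ (k : ℕ) * α (I k) * η fun l => I (k.succAbove l)

/-- The 1-form `i_A ω` for an `(r+1)`-form `ω` and an `r`-vector field
`A = ∑ J, A_J ∂_{J 0} ∧ ⋯ ∧ ∂_{J (r-1)}`. -/
def contract {r : ℕ} (A : (Fin r → Fin n) → Fun K n) (ω : FormComp K n (r + 1)) :
    Fin n → Fun K n :=
  fun k => ∑ J : Fin r → Fin n, A J * ω (Fin.snoc J k)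

/-- `η` is an infinitesimal deformation of the integrable `p`-form `ω`, i.e. `ω + ε η` is
integrable modulo `ε²`: for every `(p-1)`-vector field `A`,
`i_A ω ∧ η + i_A η ∧ ω = 0` and `i_A ω ∧ dη + i_A η ∧ dω = 0`.
For `p = 0` there is no `A` and no condition. -/
def IsInfDeformation : {p : ℕ} → FormComp K n p → FormComp K n p → Prop
  | 0, _, _ => True
  | r + 1, ω, η => ∀ A : (Fin r → Fin n) → Fun K n,
      wedge (contract A ω) η + wedge (contract A η) ω = 0 ∧
      wedge (contract A ω) (extDer η) + wedge (contract A η) (extDer ω) = 0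

/-- The `p`-form `i_X Ω`, where `Ω = dx₁ ∧ ⋯ ∧ dxₙ` and `p + 1 = n`:
`(i_X Ω)(∂_{I 0}, …, ∂_{I (p-1)}) = Ω (X, ∂_{I 0}, …, ∂_{I (p-1)})`
is the determinant with rows `X, ∂_{I 0}, …, ∂_{I (p-1)}`. -/
def volContract {p : ℕ} (h : n = p + 1) (X : VF K n) : FormComp K n p :=
  fun I => Matrix.det (Matrix.of fun r : Fin n =>
    (Fin.cons X (fun l => Pi.single (I l) 1) : Fin (p + 1) → VF K n) (Fin.cast h r))

/-! ### Linearity facts -/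

lemma extDer_add {p : ℕ} (η θ : FormComp K n p) : extDer (η + θ) = extDer η + extDer θ := by
  funext I
  simp [extDer, mul_add, Finset.sum_add_distrib]

lemma extDer_smul {p : ℕ} (c : K) (η : FormComp K n p) : extDer (c • η) = c • extDer η := by
  funext I
  simp [extDer, Finset.smul_sum]

lemma wedge_add_right {p : ℕ} (α : Fin n → Fun K n) (η θ : FormComp K n p) :
    wedge α (η + θ) = wedge α η + wedge α θ := by
  funext I
  simp [wedge, mul_add, Finset.sum_add_distrib]

lemma wedge_smul_right {p : ℕ} (c : K) (α : Fin n → Fun K n) (η : FormComp K n p) :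
    wedge α (c • η) = c • wedge α η := by
  funext I
  simp [wedge, Finset.smul_sum]

lemma wedge_add_left {p : ℕ} (α β : Fin n → Fun K n) (η : FormComp K n p) :
    wedge (α + β) η = wedge α η + wedge β η := by
  funext I
  simp [wedge, mul_add, add_mul, Finset.sum_add_distrib]

lemma wedge_smul_left {p : ℕ} (c : K) (α : Fin n → Fun K n) (η : FormComp K n p) :
    wedge (c • α) η = c • wedge α η := by
  funext I
  simp [wedge, Finset.smul_sum]

lemma contract_add {r : ℕ} (A : (Fin r → Fin n) → Fun K n) (ω η : FormComp K n (r + 1)) :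
    contract A (ω + η) = contract A ω + contract A η := by
  funext k
  simp [contract, mul_add, Finset.sum_add_distrib]

lemma contract_smul {r : ℕ} (A : (Fin r → Fin n) → Fun K n) (c : K)
    (ω : FormComp K n (r + 1)) : contract A (c • ω) = c • contract A ω := by
  funext k
  simp [contract, Finset.smul_sum]

lemma IsInfDeformation.add {p : ℕ} {ω η θ : FormComp K n p} (h₁ : IsInfDeformation ω η)
    (h₂ : IsInfDeformation ω θ) : IsInfDeformation ω (η + θ) := by
  cases p with
  | zero => trivial
  | succ r =>
    intro A
    obtain ⟨a, b⟩ := h₁ A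
    obtain ⟨a', b'⟩ := h₂ A
    rw [contract_add, extDer_add, wedge_add_right, wedge_add_right, wedge_add_left,
      wedge_add_left, add_add_add_comm, a, a', add_add_add_comm, b, b']
    simp

lemma IsInfDeformation.smul {p : ℕ} {ω η : FormComp K n p} (c : K)
    (h : IsInfDeformation ω η) : IsInfDeformation ω (c • η) := by
  cases p with
  | zero => trivial
  | succ r =>
    intro A
    obtain ⟨a, b⟩ := h A
    rw [contract_smul, extDer_smul, wedge_smul_right, wedge_smul_right, wedge_smul_left,
      wedge_smul_left, ← smul_add, a, ← smul_add, b]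
    simp

lemma volContract_eq {p : ℕ} (h : n = p + 1) (X : VF K n) (I : Fin p → Fin n) :
    volContract h X I = (Matrix.updateRow (Matrix.of fun r : Fin n =>
      (Fin.cons 0 (fun l => Pi.single (I l) 1) : Fin (p + 1) → VF K n) (Fin.cast h r))
      (Fin.cast h.symm 0) X).det := by
  subst h
  unfold volContract
  congr 1
  ext r c
  refine Fin.cases ?_ (fun l => ?_) r
  · simp
  · rw [Matrix.updateRow_ne (by simp)]
    simp

lemma volContract_add {p : ℕ} (h : n = p + 1) (X Y : VF K n) :
    volContract h (X + Y) = volContract h X + volContract h Y := by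
  funext I
  simp only [volContract_eq, Pi.add_apply, Matrix.det_updateRow_add]

lemma volContract_smul {p : ℕ} (h : n = p + 1) (c : K) (X : VF K n) :
    volContract h (c • X) = c • volContract h X := by
  funext I
  have : c • X = (MvPowerSeries.C (σ := Fin n) c) • X := by
    funext j
    simp [MvPowerSeries.smul_eq_C_mul]
  simp only [this, volContract_eq, Pi.smul_apply, Matrix.det_updateRow_smul,
    MvPowerSeries.smul_eq_C_mul]

/-! ### Deformation cohomology -/

/-- `Z(X)`: the infinitesimal deformations of `X`, that is the formal vector fields `Y` such that
`i_Y Ω` is an infinitesimal deformation of `i_X Ω`. -/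
def infDefs (X : VF K n) : Submodule K (VF K n) where
  carrier := {Y | ∀ (p : ℕ) (h : n = p + 1), IsInfDeformation (volContract h X) (volContract h Y)}
  add_mem' := fun {Y Y'} hY hY' p h => by
    rw [volContract_add]
    exact (hY p h).add (hY' p h)
  zero_mem' := fun p h => by
    have := volContract_smul h (0 : K) (0 : VF K n)
    rw [zero_smul, zero_smul] at this
    rw [this]
    cases p with
    | zero => trivial
    | succ r =>
      change IsInfDeformation _ (0 : FormComp K n (r + 1))
      intro A
      have e₁ : contract A (0 : FormComp K n (r + 1)) = 0 := by
        funext k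
        simp [contract]
      have e₂ : extDer (0 : FormComp K n (r + 1)) = 0 := by
        funext I
        simp [extDer]
      rw [e₁, e₂]
      constructor <;> funext I <;> simp [wedge]
  smul_mem' := fun c Y hY p h => by
    rw [volContract_smul]
    exact (hY p h).smul c

/-- `B(X)`: the trivial deformations `L_Z X = [Z, X]` of `X`, `Z` a formal vector field. -/
def trivialDefs (X : VF K n) : Submodule K (VF K n) where
  carrier := {Y | ∃ Z : VF K n, Y = bracket Z X}
  add_mem' := by
    rintro _ _ ⟨Z, rfl⟩ ⟨Z', rfl⟩
    refine ⟨Z + Z', ?_⟩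
    funext j
    simp only [bracket, Pi.add_apply, map_add, ← Finset.sum_add_distrib]
    exact Finset.sum_congr rfl fun i _ => by ring
  zero_mem' := ⟨0, by funext j; simp [bracket]⟩
  smul_mem' := by
    rintro c _ ⟨Z, rfl⟩
    refine ⟨c • Z, ?_⟩
    funext j
    simp [bracket, Finset.smul_sum, smul_sub]

/-- `B(F_X)`: the trivial deformations `L_Z X + f X` of the foliation `F_X`. -/
def trivialFolDefs (X : VF K n) : Submodule K (VF K n) where
  carrier := {Y | ∃ (Z : VF K n) (f : Fun K n), Y = bracket Z X + f • X}
  add_mem' := by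
    rintro _ _ ⟨Z, f, rfl⟩ ⟨Z', f', rfl⟩
    obtain ⟨W, hW⟩ := (trivialDefs X).add_mem ⟨Z, rfl⟩ ⟨Z', rfl⟩
    exact ⟨W, f + f', by rw [add_smul, ← hW]; abel⟩
  zero_mem' := ⟨0, 0, by funext j; simp [bracket]⟩
  smul_mem' := by
    rintro c _ ⟨Z, f, rfl⟩
    obtain ⟨W, hW⟩ := (trivialDefs X).smul_mem c ⟨Z, rfl⟩
    exact ⟨W, c • f, by rw [smul_add, hW, smul_assoc]⟩

/-- The deformation cohomology `DH(X) = Z(X) / B(X)`. -/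
abbrev DH (X : VF K n) := infDefs X ⧸ (trivialDefs X).submoduleOf (infDefs X)

/-- The deformation cohomology `DH(F_X) = Z(X) / B(F_X)` of the foliation defined by `X`. -/
abbrev DHFol (X : VF K n) := infDefs X ⧸ (trivialFolDefs X).submoduleOf (infDefs X)

/-! ### Linear vector fields -/

/-- The linear vector field `∑ j, (∑ i, A j i xᵢ) ∂/∂xⱼ`. -/
def linearField (A : Matrix (Fin n) (Fin n) K) : VF K n :=
  fun j => ∑ i, A j i • (MvPowerSeries.X i : Fun K n)

/-- The space of linear vector fields. -/
def linearFields (K : Type*) [Field K] (n : ℕ) : Submodule K (VF K n) where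
  carrier := {Y | ∃ A : Matrix (Fin n) (Fin n) K, Y = linearField A}
  add_mem' := by
    rintro _ _ ⟨A, rfl⟩ ⟨B, rfl⟩
    refine ⟨A + B, ?_⟩
    funext j
    simp [linearField, add_smul, Finset.sum_add_distrib]
  zero_mem' := ⟨0, by funext j; simp [linearField]⟩
  smul_mem' := by
    rintro c _ ⟨A, rfl⟩
    refine ⟨c • A, ?_⟩
    funext j
    simp [linearField, Finset.smul_sum, smul_smul]

/-- The matrix of the linear part of a formal vector field: the Jacobian matrix at the origin. -/
def linearMatrix (X : VF K n) : Matrix (Fin n) (Fin n) K :=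
  Matrix.of fun j i => MvPowerSeries.coeff (Finsupp.single i 1) (X j)

/-- The linear part `X⁽¹⁾`, a linear vector field. -/
def linearPart (X : VF K n) : VF K n := linearField (linearMatrix X)

/-- `DH_lin(L)`: linear infinitesimal deformations of `L` modulo linear trivial deformations. -/
abbrev DHLin (L : VF K n) :=
  (infDefs L ⊓ linearFields K n : Submodule K (VF K n)) ⧸
    (trivialDefs L ⊓ linearFields K n).submoduleOf (infDefs L ⊓ linearFields K n)

/-- The eigenvalues of `A` in an algebraic closure of `K`, counted with algebraic multiplicity. -/
def eigenvalues (A : Matrix (Fin n) (Fin n) K) : Multiset (AlgebraicClosure K) :=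
  (A.charpoly.map (algebraMap K (AlgebraicClosure K))).roots

/-- `A` is non-resonant: with `λ₁, …, λₙ` its eigenvalues, there is no relation
`λⱼ = m₁ λ₁ + ⋯ + mₙ λₙ` with integers `mᵢ ≥ 0`, `m₁ + ⋯ + mₙ ≥ 2`. In other words, no eigenvalue
is a sum of two or more eigenvalues, repetitions allowed. -/
def NonResonant (A : Matrix (Fin n) (Fin n) K) : Prop :=
  ∀ μ ∈ eigenvalues A, ∀ s : Multiset (AlgebraicClosure K),
    (∀ ν ∈ s, ν ∈ eigenvalues A) → 2 ≤ Multiset.card s → μ ≠ s.sum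

/-! ### The adjoint orbit and its dimension -/

/-- `S` is a smooth embedded `d`-dimensional submanifold of `E`: near each of its points it is the
zero set of a smooth map to `𝕜ᶜ`, `c + d = dim E`, that is a submersion at that point. (For
`𝕜 = ℂ` smooth means holomorphic and `d` is the complex dimension.) -/
def IsSubmanifoldOfDim (𝕜 : Type*) [RCLike 𝕜] {E : Type*} [NormedAddCommGroup E]
    [NormedSpace 𝕜 E] (S : Set E) (d : ℕ) : Prop :=
  ∀ x ∈ S, ∃ (c : ℕ) (F : E → Fin c → 𝕜), c + d = Module.finrank 𝕜 E ∧
    ContDiffAt 𝕜 (⊤ : ℕ∞) F x ∧ Function.Surjective (fderiv 𝕜 F x) ∧ ∀ᶠ y in 𝓝 x, y ∈ S ↔ F y = 0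

/-- The orbit `{g A g⁻¹}` of `A` under the adjoint action of `GLₙ(K)` on `𝔤𝔩ₙ(K)`. -/
def adjointOrbit (A : Matrix (Fin n) (Fin n) K) : Set (Matrix (Fin n) (Fin n) K) :=
  Set.range fun g : GL (Fin n) K =>
    (g : Matrix (Fin n) (Fin n) K) * A * ((g⁻¹ : GL (Fin n) K) : Matrix (Fin n) (Fin n) K)

section
attribute [local instance] Matrix.linftyOpNormedAddCommGroup Matrix.linftyOpNormedSpace

/-- The adjoint orbit of `A` is a `d`-dimensional submanifold of `𝔤𝔩ₙ(𝕜)` (all norms on this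
finite-dimensional space being equivalent, the choice of one is immaterial). -/
def AdjointOrbitHasDim {𝕜 : Type*} [RCLike 𝕜] (A : Matrix (Fin n) (Fin n) 𝕜) (d : ℕ) : Prop :=
  IsSubmanifoldOfDim 𝕜 (adjointOrbit A) d

end

end

end DefCoh

/-!
In components the two deformation equations for `i_X Ω` are antisymmetric in the pair of fields, so
every formal field is an infinitesimal deformation: `Z(X)` is the space of all formal fields.

Let `A` be the linear part of `X`. On homogeneous fields of degree `k` the operator `Z ↦ [Z, X⁽¹⁾]`
has as eigenvalues differences of an eigenvalue of `A` and a sum of `k` eigenvalues of `A`. For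
`k ≠ 1` they are nonzero (for `k = 0` because non-resonance excludes the relation `0 = 0 + 0`), so
`[Z, X] = Y` can be solved degree by degree outside degree one. What is left is the degree one
equation, and `DH(X)` becomes the cokernel of `ad A` on matrices. In `DH(F_X)` the only further
relation is that the class of `A` vanishes; this class is nonzero because `A = [A, B]` with `A`
invertible would give `n = tr 1 = 0`.

The cokernel of `ad A` has the dimension of the centralizer of `A`, which is the codimension of the
adjoint orbit. Over `K[x]`, with `x` acting by `A`, the space `Kⁿ` is isomorphic to a commutative
algebra acting faithfully on itself by operators commuting with `A`, so the centralizer has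
dimension at least `n`; it has dimension exactly `n` when `Kⁿ` is cyclic.
-/

namespace DefCoh

open scoped Topology

noncomputable section

/-! ### Contractions of the volume form -/

section Forms

lemma alternatingMap_update_eq_sum {R M ι κ : Type*} [Semiring R] [AddCommMonoid M] [Module R M]
    [DecidableEq ι] [Fintype κ] [DecidableEq κ] (f : (κ → R) [⋀^ι]→ₗ[R] M) (v : ι → κ → R)
    (i : ι) (y : κ → R) :
    f (Function.update v i y) = ∑ j, y j • f (Function.update v i (Pi.single j 1)) := by
  conv_lhs => rw [pi_eq_sum_univ' y]
  simp only [AlternatingMap.map_update_sum, AlternatingMap.map_update_smul]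

lemma sum_neg_one_pow_mul_dotProduct_mul_det_eq_zero {R : Type*} [CommRing R] {n : ℕ}
    (α : Fin n → R) (v : Fin (n + 1) → Fin n → R) :
    ∑ k : Fin (n + 1), (-1) ^ (k : ℕ) * (α ⬝ᵥ v k) *
      Matrix.detRowAlternating (fun i => v (k.succAbove i)) = 0 := by
  -- The vectors `(α(v₀), v₀), …, (α(vₙ), vₙ)` lie on a hyperplane of `Rⁿ⁺¹`: expand their
  -- determinant along the first column.
  let M : Matrix (Fin (n + 1)) (Fin (n + 1)) R := Matrix.of fun k => Fin.cons (α ⬝ᵥ v k) (v k)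
  let w : Fin (n + 1) → R := Fin.cons 1 (-α)
  have hMw : M.mulVec w = 0 := by
    funext k
    simp [M, w, Matrix.mulVec, dotProduct, Fin.sum_univ_succ, mul_comm]
  have hdet : M.det = 0 :=
    Matrix.det_eq_zero_of_mulVec_eq_zero_of_mem_nonZeroDivisors hMw (i := 0) (one_mem _)
  rw [Matrix.det_succ_column_zero] at hdet
  exact hdet

variable {K : Type*} [Field K] {n p : ℕ}

/-- The volume form `Ω = dx₁ ∧ ⋯ ∧ dxₙ` in components. -/
def volComp (K : Type*) [Field K] (n : ℕ) : FormComp K n n :=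
  fun I => Matrix.detRowAlternating (fun i => (Pi.single (I i) 1 : VF K n))

lemma volContract_apply (X : VF K (p + 1)) (I : Fin p → Fin (p + 1)) :
    volContract rfl X I = Matrix.detRowAlternating
      (Fin.cons X (fun l => Pi.single (I l) 1) : Fin (p + 1) → VF K (p + 1)) :=
  rfl

lemma volContract_eq_sum (Y : VF K (p + 1)) (I : Fin p → Fin (p + 1)) :
    volContract rfl Y I = ∑ j, Y j * volContract rfl (Pi.single j 1 : VF K (p + 1)) I := by
  simpa only [Fin.update_cons_zero, volContract_apply, smul_eq_mul] using
    alternatingMap_update_eq_sum Matrix.detRowAlternating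
      (Fin.cons 0 (fun l => Pi.single (I l) 1) : Fin (p + 1) → VF K (p + 1)) 0 Y

lemma wedge_volContract (α : Fin (p + 1) → Fun K (p + 1)) (Y : VF K (p + 1)) :
    wedge α (volContract rfl Y) = (α ⬝ᵥ Y) • volComp K (p + 1) := by
  funext I
  have h := sum_neg_one_pow_mul_dotProduct_mul_det_eq_zero α
    (Fin.cons Y fun k => Pi.single (I k) 1 : Fin (p + 1 + 1) → VF K (p + 1))
  rw [Fin.sum_univ_succ] at h
  simp only [Fin.val_zero, pow_zero, one_mul, Fin.cons_zero, Fin.zero_succAbove, Fin.cons_succ,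
    Fin.val_succ, dotProduct_single_one, pow_succ, mul_neg_one, neg_mul,
    Finset.sum_neg_distrib] at h
  rw [Pi.smul_apply, smul_eq_mul, volComp, eq_of_sub_eq_zero ((sub_eq_add_neg _ _).trans h), wedge]
  refine Finset.sum_congr rfl fun k _ => ?_
  rw [volContract_apply]
  congr 2
  funext i
  cases i using Fin.cases <;> simp

lemma wedge_smul_volComp (α : Fin n → Fun K n) (c : Fun K n) :
    wedge α (c • volComp K n) = 0 := by
  funext I
  have h := sum_neg_one_pow_mul_dotProduct_mul_det_eq_zero α
    (fun k => Pi.single (I k) 1 : Fin (n + 1) → VF K n)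
  simp only [dotProduct_single_one] at h
  calc wedge α (c • volComp K n) I
      = c * ∑ k : Fin (n + 1), (-1) ^ (k : ℕ) * α (I k) *
          volComp K n (fun l => I (k.succAbove l)) := by
        simp only [wedge, Pi.smul_apply, smul_eq_mul, Finset.mul_sum, mul_left_comm c]
    _ = 0 := by rw [← mul_zero c, ← h]; rfl

lemma pd_volContract_single (i j : Fin (p + 1)) (I : Fin p → Fin (p + 1)) :
    pd i (volContract rfl (Pi.single j 1 : VF K (p + 1)) I) = 0 := by
  have hconst : volContract rfl (Pi.single j 1 : VF K (p + 1)) I =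
      MvPowerSeries.C (Matrix.det (Matrix.of
        (Fin.cons (Pi.single j 1) (fun l => Pi.single (I l) 1) :
          Fin (p + 1) → Fin (p + 1) → K))) := by
    rw [RingHom.map_det, volContract]
    congr 1
    ext1 r c
    cases r using Fin.cases <;> simp [Pi.single_apply, apply_ite]
  rw [hconst]
  exact MvPowerSeries.pderiv_C

lemma extDer_volContract (Y : VF K (p + 1)) :
    extDer (volContract rfl Y) = (∑ j, pd j (Y j)) • volComp K (p + 1) := by
  have h : extDer (volContract rfl Y) =
      ∑ j, wedge (fun i => pd i (Y j)) (volContract rfl (Pi.single j 1 : VF K (p + 1))) := by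
    funext I
    simp only [extDer, wedge, Finset.sum_apply]
    rw [Finset.sum_comm]
    refine Finset.sum_congr rfl fun k _ => ?_
    rw [volContract_eq_sum, pd, map_sum, Finset.mul_sum]
    refine Finset.sum_congr rfl fun j _ => ?_
    have hpd :
        MvPowerSeries.pderiv K (I k) (volContract rfl (Pi.single j 1 : VF K (p + 1)) _) = 0 :=
      pd_volContract_single (I k) j fun l => I (k.succAbove l)
    rw [Derivation.leibniz, hpd, smul_zero, zero_add, smul_eq_mul]
    ring
  simp only [h, wedge_volContract, dotProduct_single_one, Finset.sum_smul]

lemma sum_volContract_snoc {r : ℕ} (X Y : VF K (r + 2)) (J : Fin r → Fin (r + 2)) :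
    ∑ k, volContract rfl X (Fin.snoc J k : Fin (r + 1) → Fin (r + 2)) * Y k =
      Matrix.detRowAlternating (Fin.cons X (Fin.snoc (fun l => Pi.single (J l) 1) Y :
        Fin (r + 1) → VF K (r + 2)) : Fin (r + 2) → VF K (r + 2)) := by
  have h := alternatingMap_update_eq_sum Matrix.detRowAlternating
    (Fin.cons X (Fin.snoc (fun l => Pi.single (J l) 1) 0 : Fin (r + 1) → VF K (r + 2)) :
      Fin (r + 2) → VF K (r + 2)) (Fin.last r).succ Y
  simp only [← Fin.cons_update, Fin.update_snoc_last, smul_eq_mul] at h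
  rw [h]
  refine Finset.sum_congr rfl fun k _ => ?_
  rw [mul_comm, volContract_apply]
  congr 3
  funext l
  cases l using Fin.lastCases <;> simp only [Fin.snoc_last, Fin.snoc_castSucc]

lemma contract_volContract_dotProduct {r : ℕ} (A : (Fin r → Fin (r + 2)) → Fun K (r + 2))
    (X Y : VF K (r + 2)) :
    contract A (volContract rfl X) ⬝ᵥ Y = ∑ J, A J * Matrix.detRowAlternating
      (Fin.cons X (Fin.snoc (fun l => Pi.single (J l) 1) Y : Fin (r + 1) → VF K (r + 2)) :
        Fin (r + 2) → VF K (r + 2)) := by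
  simp only [← sum_volContract_snoc, dotProduct, contract, Finset.sum_mul, Finset.mul_sum]
  rw [Finset.sum_comm]
  simp only [mul_assoc]

lemma contract_volContract_dotProduct_add_swap {r : ℕ}
    (A : (Fin r → Fin (r + 2)) → Fun K (r + 2)) (X Y : VF K (r + 2)) :
    contract A (volContract rfl X) ⬝ᵥ Y + contract A (volContract rfl Y) ⬝ᵥ X = 0 := by
  rw [contract_volContract_dotProduct, contract_volContract_dotProduct, ← Finset.sum_add_distrib]
  refine Finset.sum_eq_zero fun J _ => ?_
  have hswap : (Fin.cons Y (Fin.snoc (fun l => Pi.single (J l) 1) X :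
        Fin (r + 1) → VF K (r + 2)) : Fin (r + 2) → VF K (r + 2)) =
      (Fin.cons X (Fin.snoc (fun l => Pi.single (J l) 1) Y :
        Fin (r + 1) → VF K (r + 2)) : Fin (r + 2) → VF K (r + 2)) ∘
        Equiv.swap 0 (Fin.last r).succ := by
    funext i
    cases i using Fin.cases with
    | zero => simp
    | succ l =>
      cases l using Fin.lastCases with
      | last => simp
      | cast m =>
        rw [Function.comp_apply, Equiv.swap_apply_of_ne_of_ne (Fin.succ_ne_zero _)
          (fun h => (Fin.castSucc_lt_last m).ne (Fin.succ_injective _ h))]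
        simp
  rw [hswap, AlternatingMap.map_swap _ _ (Fin.succ_ne_zero _).symm, mul_neg, add_neg_cancel]

theorem infDefs_eq_top (X : VF K n) : infDefs X = ⊤ := by
  refine eq_top_iff.2 fun Y _ p h => ?_
  cases p with
  | zero => trivial
  | succ r =>
    subst h
    refine fun A => ⟨?_, ?_⟩
    · rw [wedge_volContract, wedge_volContract, ← add_smul,
        contract_volContract_dotProduct_add_swap, zero_smul]
    · rw [extDer_volContract, extDer_volContract, wedge_smul_volComp, wedge_smul_volComp, add_zero]

end Forms

/-! ### The adjoint orbit -/

section LinearAlgebra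

variable {k V W : Type*} [Field k] [AddCommGroup V] [Module k V] [AddCommGroup W] [Module k W]

lemma exists_generalized_inverse (f : V →ₗ[k] W) : ∃ J : W →ₗ[k] V, ∀ x, f (J (f x)) = f x := by
  obtain ⟨s, hs⟩ := f.rangeRestrict.exists_rightInverse_of_surjective f.range_rangeRestrict
  obtain ⟨J, hJ⟩ := LinearMap.exists_extend s
  refine ⟨J, fun x => ?_⟩
  have hJs : J (f x) = s (f.rangeRestrict x) := DFunLike.congr_fun hJ (f.rangeRestrict x)
  rw [hJs]
  exact congrArg Subtype.val (DFunLike.congr_fun hs (f.rangeRestrict x))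

lemma exists_surjective_ker_eq [FiniteDimensional k V] (U : Submodule k V) :
    ∃ (c : ℕ) (q : V →ₗ[k] Fin c → k),
      c + Module.finrank k U = Module.finrank k V ∧ Function.Surjective q ∧ q.ker = U := by
  let e := (Module.finBasis k (V ⧸ U)).equivFun
  exact ⟨_, e.toLinearMap ∘ₗ U.mkQ, U.finrank_quotient_add_finrank,
    e.surjective.comp U.mkQ_surjective, by rw [LinearEquiv.ker_comp, U.ker_mkQ]⟩

variable {S T : V →ₗ[k] W} {J : W →ₗ[k] V}

lemma apply_add_generalized_inverse_sub (hJ : ∀ x, T (J (T x)) = T x) (x : V) :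
    T (x + J (S x - T x)) = T (J (S x)) := by
  rw [map_add, map_sub, map_sub, hJ, add_sub_cancel]

/-- The perturbation `x + J (S x - T x)` of the identity maps `ker S` into `ker T`, hence
isomorphically onto it when it is injective and the dimensions agree. -/
lemma apply_eq_zero_of_finrank_ker_eq [FiniteDimensional k V] (hJ : ∀ x, T (J (T x)) = T x)
    (hinj : Function.Injective fun x => x + J (S x - T x))
    (hker : Module.finrank k S.ker = Module.finrank k T.ker) {x : V}
    (hx : T (x + J (S x - T x)) = 0) : S x = 0 := by
  let N : S.ker →ₗ[k] T.ker := (LinearMap.id + J ∘ₗ (S - T)).restrict fun v hv => by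
    simpa [LinearMap.mem_ker.1 hv] using apply_add_generalized_inverse_sub (S := S) hJ v
  have hN : Function.Injective N := fun v w hvw => Subtype.ext (hinj (congrArg Subtype.val hvw))
  obtain ⟨v, hv⟩ := (LinearMap.injective_iff_surjective_of_finrank_eq_finrank hker).1 hN ⟨_, hx⟩
  rw [← hinj (congrArg Subtype.val hv)]
  exact v.2

lemma apply_eq_zero_of_mem_range (hJ : ∀ x, T (J (T x)) = T x) {x : V}
    (hx : T (x + J (S x - T x)) = 0) (hrange : S x ∈ T.range) : S x = 0 := by
  obtain ⟨y, hy⟩ := hrange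
  rw [← hx, apply_add_generalized_inverse_sub hJ, ← hy, hJ]

end LinearAlgebra

section Intertwining

variable (k : Type*) {R : Type*} [Field k] [Ring R] [Algebra k R]

/-- The operator `g ↦ b g - g a`, whose kernel is the space of intertwiners of `a` and `b`. For
`a = b` it is the adjoint action of `a`. -/
def intertwining (a b : R) : R →ₗ[k] R := LinearMap.mulLeft k b - LinearMap.mulRight k a

variable {k}

@[simp] lemma intertwining_apply (a b g : R) : intertwining k a b g = b * g - g * a := rfl

lemma finrank_ker_intertwining_eq_of_isConj {a a' b b' : R} (ha : IsConj a a')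
    (hb : IsConj b b') :
    Module.finrank k (intertwining k a b).ker = Module.finrank k (intertwining k a' b').ker := by
  obtain ⟨u, hu⟩ := ha
  obtain ⟨w, hw⟩ := hb
  let e : R ≃ₗ[k] R := LinearEquiv.ofLinearMap
    (LinearMap.mulLeft k (w : R) ∘ₗ LinearMap.mulRight k (↑u⁻¹ : R))
    (LinearMap.mulLeft k (↑w⁻¹ : R) ∘ₗ LinearMap.mulRight k (u : R))
    (by ext g; simp [← mul_assoc]) (by ext g; simp [← mul_assoc])
  have he : e.toLinearMap ∘ₗ intertwining k a b = intertwining k a' b' ∘ₗ e.toLinearMap := by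
    ext g
    change w * ((b * g - g * a) * ↑u⁻¹) = b' * (w * (g * ↑u⁻¹)) - w * (g * ↑u⁻¹) * a'
    have hu' : (↑u⁻¹ : R) * a' = a * ↑u⁻¹ := hu.units_inv_symm_left.eq
    simp only [mul_assoc, hu', sub_mul, mul_sub, ← mul_assoc b' (w : R), ← hw.eq]
  have hker : (intertwining k a b).ker = (intertwining k a' b').ker.comap e.toLinearMap := by
    rw [← LinearMap.ker_comp, ← he, LinearEquiv.ker_comp]
  rw [hker]
  exact (e.ofSubmodule' _).finrank_eq

end Intertwining

section Orbit

variable {𝕜 R : Type*} [NontriviallyNormedField 𝕜] [NormedRing R] [NormedAlgebra 𝕜 R]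

/-- For `b` near `a`, the solution `g` of `g + J ((b - a) g) = 1`. When `J` is a generalized inverse
of the adjoint action of `a`, this `g` intertwines `a` and `b` as soon as the two are conjugate. -/
def nearIntertwiner (J : R →L[𝕜] R) (a b : R) : R :=
  Ring.inverse (1 + J ∘L ContinuousLinearMap.mul 𝕜 R (b - a)) 1

@[simp] lemma nearIntertwiner_self (J : R →L[𝕜] R) (a : R) : nearIntertwiner J a a = 1 := by
  simp [nearIntertwiner]

lemma contDiffAt_nearIntertwiner [CompleteSpace R] (J : R →L[𝕜] R) (a : R) :
    ContDiffAt 𝕜 (⊤ : ℕ∞) (nearIntertwiner J a) a := by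
  have hN : ContDiff 𝕜 (⊤ : ℕ∞) fun b => 1 + J ∘L ContinuousLinearMap.mul 𝕜 R (b - a) := by
    fun_prop
  have hinv :
      ContDiffAt 𝕜 (⊤ : ℕ∞) Ring.inverse (1 + J ∘L ContinuousLinearMap.mul 𝕜 R (a - a)) := by
    simpa using contDiffAt_ringInverse 𝕜 (n := (⊤ : ℕ∞)) (1 : (R →L[𝕜] R)ˣ)
  exact (hinv.comp a hN.contDiffAt).clm_apply contDiffAt_const

lemma eventually_isUnit_nearIntertwiner [CompleteSpace R] (J : R →L[𝕜] R) (a : R) :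
    ∀ᶠ b in 𝓝 a, IsUnit (nearIntertwiner J a b) :=
  (contDiffAt_nearIntertwiner J a).continuousAt.eventually (p := IsUnit) <| by
    rw [nearIntertwiner_self]
    exact Units.isOpen.mem_nhds isUnit_one

lemma eventually_isUnit_one_add_comp_mul_sub [CompleteSpace R] (J : R →L[𝕜] R) (a : R) :
    ∀ᶠ b in 𝓝 a, IsUnit (1 + J ∘L ContinuousLinearMap.mul 𝕜 R (b - a)) := by
  have hN : Continuous fun b => 1 + J ∘L ContinuousLinearMap.mul 𝕜 R (b - a) := by fun_prop
  refine hN.continuousAt.eventually (p := IsUnit) ?_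
  simp only [sub_self, map_zero, ContinuousLinearMap.comp_zero, add_zero]
  exact Units.isOpen.mem_nhds isUnit_one

lemma eventually_isConj_iff [CompleteSpace 𝕜] [FiniteDimensional 𝕜 R] {J : R →L[𝕜] R} {a : R}
    (hJ : ∀ x, intertwining 𝕜 a a (J (intertwining 𝕜 a a x)) = intertwining 𝕜 a a x) :
    ∀ᶠ b in 𝓝 a, IsConj a b ↔
      intertwining 𝕜 a b (nearIntertwiner J a b) ∈ (intertwining 𝕜 a a).range := by
  have : CompleteSpace R := FiniteDimensional.complete 𝕜 R
  filter_upwards [eventually_isUnit_one_add_comp_mul_sub J a, eventually_isUnit_nearIntertwiner J a]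
    with b hN hg
  set g := nearIntertwiner J a b
  set N := 1 + J ∘L ContinuousLinearMap.mul 𝕜 R (b - a)
  have hNx (x : R) : N x = x + J (intertwining 𝕜 a b x - intertwining 𝕜 a a x) := by
    simp [N]
  have hNg : N g = 1 := DFunLike.congr_fun (Ring.mul_inverse_cancel N hN) 1
  have hTg : intertwining 𝕜 a a (g + J (intertwining 𝕜 a b g - intertwining 𝕜 a a g)) = 0 := by
    rw [← hNx, hNg]
    simp
  have hinj : Function.Injective fun x =>
      x + J (intertwining 𝕜 a b x - intertwining 𝕜 a a x) := funext hNx ▸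
    Function.LeftInverse.injective fun x => DFunLike.congr_fun (Ring.inverse_mul_cancel N hN) x
  constructor
  · intro hab
    rw [apply_eq_zero_of_finrank_ker_eq (J := J.toLinearMap) hJ hinj
      (finrank_ker_intertwining_eq_of_isConj (IsConj.refl a) hab.symm) hTg]
    exact zero_mem _
  · intro hrange
    have hbg := apply_eq_zero_of_mem_range (J := J.toLinearMap) hJ hTg hrange
    rw [intertwining_apply, sub_eq_zero] at hbg
    exact ⟨hg.unit, hbg.symm⟩

lemma hasFDerivAt_intertwining {g : R → R} {g' : R →L[𝕜] R} {a : R} (hg : HasFDerivAt g g' a)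
    (hga : g a = 1) :
    HasFDerivAt (fun b => intertwining 𝕜 a b (g b))
      (ContinuousLinearMap.id 𝕜 R + (ContinuousLinearMap.mul 𝕜 R a -
        (ContinuousLinearMap.mul 𝕜 R).flip a) ∘L g') a := by
  refine (((hasFDerivAt_id a).mul' hg).sub (hg.mul_const' a)).congr_fderiv ?_
  ext x
  simp [hga]
  abel

lemma exists_submersion_conjugatesOf [CompleteSpace 𝕜] [FiniteDimensional 𝕜 R] (a : R) :
    ∃ (c : ℕ) (F : R → Fin c → 𝕜),
      c + Module.finrank 𝕜 (intertwining 𝕜 a a).range = Module.finrank 𝕜 R ∧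
      ContDiffAt 𝕜 (⊤ : ℕ∞) F a ∧ Function.Surjective (fderiv 𝕜 F a) ∧
      ∀ᶠ b in 𝓝 a, b ∈ conjugatesOf a ↔ F b = 0 := by
  have : CompleteSpace R := FiniteDimensional.complete 𝕜 R
  obtain ⟨J, hJ⟩ := exists_generalized_inverse (intertwining 𝕜 a a)
  obtain ⟨c, q, hc, hq, hker⟩ := exists_surjective_ker_eq (intertwining 𝕜 a a).range
  let g := nearIntertwiner (LinearMap.toContinuousLinearMap J) a
  have hg : ContDiffAt 𝕜 (⊤ : ℕ∞) g a := contDiffAt_nearIntertwiner _ a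
  refine ⟨c, fun b => LinearMap.toContinuousLinearMap q (intertwining 𝕜 a b (g b)), hc, ?_, ?_, ?_⟩
  · exact ContinuousLinearMap.contDiff _ |>.contDiffAt.comp a
      ((contDiffAt_id.mul hg).sub (hg.mul contDiffAt_const))
  · have hF := (LinearMap.toContinuousLinearMap q).hasFDerivAt.comp a
      (hasFDerivAt_intertwining (hg.differentiableAt (by simp)).hasFDerivAt
        (nearIntertwiner_self _ a))
    convert hq
    funext x
    have hqT : q (intertwining 𝕜 a a (fderiv 𝕜 g a x)) = 0 :=
      LinearMap.mem_ker.1 (hker ▸ LinearMap.mem_range_self _ _)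
    refine (DFunLike.congr_fun hF.fderiv x).trans ?_
    change q (x + intertwining 𝕜 a a (fderiv 𝕜 g a x)) = q x
    rw [map_add, hqT, add_zero]
  · filter_upwards [eventually_isConj_iff (J := LinearMap.toContinuousLinearMap J) hJ] with b hb
    rw [conjugatesOf, Set.mem_ofPred, hb, ← hker]
    rfl

theorem isSubmanifoldOfDim_conjugatesOf {𝕜 R : Type*} [RCLike 𝕜] [NormedRing R]
    [NormedAlgebra 𝕜 R] [FiniteDimensional 𝕜 R] (a : R) :
    IsSubmanifoldOfDim 𝕜 (conjugatesOf a) (Module.finrank 𝕜 (intertwining 𝕜 a a).range) := by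
  intro b hab
  obtain ⟨c, F, hc, hF⟩ := exists_submersion_conjugatesOf (𝕜 := 𝕜) b
  have hker := finrank_ker_intertwining_eq_of_isConj (k := 𝕜) hab hab
  have hrank := (intertwining 𝕜 a a).finrank_range_add_finrank_ker
  have hrank' := (intertwining 𝕜 b b).finrank_range_add_finrank_ker
  exact ⟨c, F, by omega, IsConj.conjugatesOf_eq hab ▸ hF⟩

end Orbit

section AdjointOrbit

attribute [local instance] Matrix.linftyOpNormedAddCommGroup Matrix.linftyOpNormedSpace
  Matrix.linftyOpNormedRing Matrix.linftyOpNormedAlgebra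

lemma adjointOrbit_eq_conjugatesOf {K : Type*} [Field K] {n : ℕ} (A : Matrix (Fin n) (Fin n) K) :
    adjointOrbit A = conjugatesOf A := by
  ext B
  exact exists_congr fun g => by rw [SemiconjBy, Units.mul_inv_eq_iff_eq_mul]

theorem adjointOrbitHasDim {𝕜 : Type*} [RCLike 𝕜] {n : ℕ} (A : Matrix (Fin n) (Fin n) 𝕜) :
    AdjointOrbitHasDim A (Module.finrank 𝕜 (intertwining 𝕜 A A).range) := by
  rw [AdjointOrbitHasDim, adjointOrbit_eq_conjugatesOf]
  exact isSubmanifoldOfDim_conjugatesOf (𝕜 := 𝕜) A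

end AdjointOrbit

/-! ### The dimension of the centralizer -/

section Centralizer

open Polynomial

lemma exists_injective_linearMap_end_of_linearEquiv {R M P : Type*} [CommRing R] [AddCommGroup M]
    [Module R M] [CommRing P] [Algebra R P] (e : M ≃ₗ[R] P) :
    ∃ ν : M →ₗ[R] Module.End R M, Function.Injective ν := by
  refine ⟨e.symm.conj.toLinearMap ∘ₗ LinearMap.mul R P ∘ₗ e.toLinearMap, fun a b h => ?_⟩
  apply e.injective
  simpa using DFunLike.congr_fun h (e.symm 1)

variable {K V : Type*} [Field K] [AddCommGroup V] [Module K V] [FiniteDimensional K V]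

/-- As a `K[X]`-module `V` is a finite product of quotients of `K[X]`, hence is isomorphic to a
commutative `K[X]`-algebra, which acts faithfully on itself. -/
lemma exists_injective_commute (f : Module.End K V) :
    ∃ ν : V →ₗ[K] Module.End K V, Function.Injective ν ∧ ∀ v, Commute f (ν v) := by
  obtain ⟨ι, _, p, -, e, ⟨E⟩⟩ := Module.equiv_directSum_of_isTorsion
    (Module.AEval.isTorsion_of_finiteDimensional K V f)
  obtain ⟨ν, hν⟩ := exists_injective_linearMap_end_of_linearEquiv
    (P := ∀ i, K[X] ⧸ Ideal.span {p i ^ e i})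
    (E ≪≫ₗ DirectSum.linearEquivFunOnFintype K[X] ι fun i => K[X] ⧸ Ideal.span {p i ^ e i})
  let o := Module.AEval'.of f
  refine ⟨o.symm.conj.toLinearMap ∘ₗ LinearMap.restrictScalarsₗ K K[X] _ _ K ∘ₗ
    ν.restrictScalars K ∘ₗ o.toLinearMap, ?_, fun v => LinearMap.ext fun x => o.injective ?_⟩
  · exact o.symm.conj.injective.comp
      ((LinearMap.restrictScalars_injective K).comp (hν.comp o.injective))
  · have ho (y : V) : o (f y) = (X : K[X]) • o y := (Module.AEval'.X_smul_of f y).symm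
    simp [LinearEquiv.conj_apply, ho]

lemma finrank_le_finrank_ker_intertwining (f : Module.End K V) :
    Module.finrank K V ≤ Module.finrank K (intertwining K f f).ker := by
  obtain ⟨ν, hν, hcomm⟩ := exists_injective_commute f
  let g : V →ₗ[K] (intertwining K f f).ker :=
    ν.codRestrict _ fun v => sub_eq_zero.2 (hcomm v).eq
  exact LinearMap.finrank_le_finrank_of_injective (f := g)
    (Function.Injective.of_comp (f := Subtype.val) hν)

lemma exists_cyclic_vector {f : Module.End K V}
    (hf : (minpoly K f).natDegree = Module.finrank K V) :
    ∃ v, ∀ w, ∃ p : K[X], aeval f p v = w := by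
  obtain ⟨x, hx⟩ := Module.exists_ker_toSpanSingleton_eq_annihilator K[X] (Module.AEval' f)
  have hfinrank : Module.finrank K (LinearMap.toSpanSingleton K[X] _ x).range =
      Module.finrank K (Module.AEval' f) := by
    rw [← (LinearMap.quotKerEquivRange _ |>.restrictScalars K).finrank_eq, hx,
      ← span_minpoly_eq_annihilator, finrank_quotient_span_eq_natDegree, hf,
      (Module.AEval'.of f).finrank_eq]
  have htop : (LinearMap.toSpanSingleton K[X] _ x).range = ⊤ := by
    apply Submodule.restrictScalars_injective K
    exact Submodule.eq_top_of_finrank_eq hfinrank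
  refine ⟨(Module.AEval'.of f).symm x, fun w => ?_⟩
  obtain ⟨p, hp⟩ := LinearMap.range_eq_top.1 htop (Module.AEval'.of f w)
  exact ⟨p, (Module.AEval'.of f).injective hp⟩

lemma finrank_ker_intertwining_of_natDegree_minpoly {f : Module.End K V}
    (hf : (minpoly K f).natDegree = Module.finrank K V) :
    Module.finrank K (intertwining K f f).ker = Module.finrank K V := by
  refine le_antisymm ?_ (finrank_le_finrank_ker_intertwining f)
  obtain ⟨v, hv⟩ := exists_cyclic_vector hf
  let ev : (intertwining K f f).ker →ₗ[K] V := LinearMap.applyₗ v ∘ₗ Submodule.subtype _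
  refine LinearMap.finrank_le_finrank_of_injective (f := ev) ?_
  refine (injective_iff_map_eq_zero ev).2 fun ⟨g, hg⟩ hgv => Subtype.ext (LinearMap.ext fun w => ?_)
  obtain ⟨p, rfl⟩ := hv w
  have hcomm : Commute g (aeval f p) := by
    have hf : f ∈ Subalgebra.centralizer K {g} :=
      Subalgebra.mem_centralizer_iff K |>.2 fun _ h => by
        rw [Set.mem_singleton_iff.1 h]; exact (sub_eq_zero.1 hg).symm
    exact Subalgebra.mem_centralizer_iff K |>.1
      (Algebra.adjoin_le (Set.singleton_subset_iff.2 hf) (aeval_mem_adjoin_singleton K f)) g rfl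
  calc g (aeval f p v) = aeval f p (g v) := DFunLike.congr_fun hcomm.eq v
    _ = 0 := by rw [show g v = 0 from hgv, map_zero]

lemma finrank_ker_intertwining_algEquiv {R S : Type*} [Ring R] [Algebra K R] [Ring S] [Algebra K S]
    (e : R ≃ₐ[K] S) (a : R) :
    Module.finrank K (intertwining K (e a) (e a)).ker =
      Module.finrank K (intertwining K a a).ker := by
  have hker : (intertwining K a a).ker = (intertwining K (e a) (e a)).ker.comap e.toLinearMap := by
    ext g
    change a * g - g * a = 0 ↔ e a * e g - e g * e a = 0
    rw [← map_mul, ← map_mul, ← map_sub, EmbeddingLike.map_eq_zero_iff]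
  rw [hker]
  exact (e.toLinearEquiv.ofSubmodule' _).finrank_eq.symm

variable {n : ℕ}

lemma le_finrank_ker_intertwining (A : Matrix (Fin n) (Fin n) K) :
    n ≤ Module.finrank K (intertwining K A A).ker := by
  simpa [finrank_ker_intertwining_algEquiv] using
    finrank_le_finrank_ker_intertwining (Matrix.toLinAlgEquiv' A)

lemma card_eigenvalues (A : Matrix (Fin n) (Fin n) K) : Multiset.card (eigenvalues A) = n := by
  rw [eigenvalues, splits_iff_card_roots.1 (IsAlgClosed.splits _), natDegree_map,
    Matrix.charpoly_natDegree_eq_dim, Fintype.card_fin]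

lemma isRoot_minpoly_of_mem_eigenvalues {A : Matrix (Fin n) (Fin n) K}
    {μ : AlgebraicClosure K} (h : μ ∈ eigenvalues A) :
    ((minpoly K A).map (algebraMap K (AlgebraicClosure K))).IsRoot μ := by
  set B := A.map (algebraMap K (AlgebraicClosure K))
  have hB : aeval B ((minpoly K A).map (algebraMap K (AlgebraicClosure K))) = 0 := by
    have hmap := aeval_algHom_apply (Algebra.ofId K (AlgebraicClosure K)).mapMatrix A (minpoly K A)
    rw [minpoly.aeval, map_zero] at hmap
    rw [aeval_map_algebraMap]
    exact hmap
  have hroot : (Matrix.toLin' B).charpoly.IsRoot μ := by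
    rw [Matrix.charpoly_toLin', Matrix.charpoly_map]
    exact isRoot_of_mem_roots h
  have := Module.End.isRoot_of_hasEigenvalue
    ((Module.End.hasEigenvalue_iff_isRoot_charpoly _ μ).2 hroot)
  rw [Matrix.minpoly_toLin'] at this
  exact this.dvd (minpoly.dvd _ _ hB)

lemma natDegree_minpoly_of_nodup {A : Matrix (Fin n) (Fin n) K} (h : (eigenvalues A).Nodup) :
    (minpoly K A).natDegree = n := by
  refine le_antisymm ?_ ?_
  · simpa using natDegree_le_of_dvd A.minpoly_dvd_charpoly A.charpoly_monic.ne_zero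
  · have hne : (minpoly K A).map (algebraMap K (AlgebraicClosure K)) ≠ 0 :=
      map_ne_zero (minpoly.ne_zero_of_finite K A)
    have hle : eigenvalues A ≤ ((minpoly K A).map (algebraMap K (AlgebraicClosure K))).roots :=
      (Multiset.le_iff_subset h).2 fun μ hμ =>
        (mem_roots hne).2 (isRoot_minpoly_of_mem_eigenvalues hμ)
    calc n = Multiset.card (eigenvalues A) := (card_eigenvalues A).symm
      _ ≤ _ := Multiset.card_le_card hle
      _ ≤ _ := card_roots' _
      _ = (minpoly K A).natDegree := natDegree_map _

theorem finrank_ker_intertwining_of_nodup {A : Matrix (Fin n) (Fin n) K}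
    (h : (eigenvalues A).Nodup) : Module.finrank K (intertwining K A A).ker = n := by
  have hdeg : (minpoly K (Matrix.toLinAlgEquiv' A)).natDegree = Module.finrank K (Fin n → K) := by
    rw [minpoly.algEquiv_eq, natDegree_minpoly_of_nodup h, Module.finrank_fin_fun]
  rw [← finrank_ker_intertwining_algEquiv Matrix.toLinAlgEquiv' A,
    finrank_ker_intertwining_of_natDegree_minpoly hdeg, Module.finrank_fin_fun]

end Centralizer

/-! ### Eigenvalues of linear vector fields on homogeneous functions -/

section Graded

open MvPowerSeries

lemma isUnit_of_surjective_of_comp_eq {F M P : Type*} [Field F] [AddCommGroup M] [Module F M]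
    [AddCommGroup P] [Module F P] [FiniteDimensional F P] {f : Module.End F M}
    {T : Module.End F P} {Φ : M →ₗ[F] P} (hΦ : Function.Surjective Φ) (h : T ∘ₗ Φ = Φ ∘ₗ f)
    (hf : IsUnit f) : IsUnit T := by
  rw [LinearMap.isUnit_iff_range_eq_top, LinearMap.range_eq_top]
  refine Function.Surjective.of_comp (g := Φ) ?_
  rw [← LinearMap.coe_comp, h, LinearMap.coe_comp]
  exact hΦ.comp ((Module.End.isUnit_iff f).1 hf).surjective

lemma exists_hasEigenvalue_of_comp_eq {F M P : Type*} [Field F] [IsAlgClosed F] [AddCommGroup M]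
    [Module F M] [FiniteDimensional F M] [AddCommGroup P] [Module F P] {f : Module.End F M}
    {T : Module.End F P} {Φ : M →ₗ[F] P} (h : T ∘ₗ Φ = Φ ∘ₗ f) (hΦ : Φ ≠ 0) :
    ∃ a, f.HasEigenvalue a ∧ ∃ g ∈ Φ.range, g ≠ 0 ∧ T g = a • g := by
  have hT : ∀ g ∈ Φ.range, T g ∈ Φ.range := by
    rintro _ ⟨v, rfl⟩
    exact ⟨f v, (DFunLike.congr_fun h v).symm⟩
  have : Nontrivial Φ.range :=
    Submodule.nontrivial_iff_ne_bot.2 fun hbot => hΦ (LinearMap.range_eq_bot.1 hbot)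
  obtain ⟨a, ha⟩ := Module.End.exists_eigenvalue (T.restrict hT)
  obtain ⟨g, hg⟩ := ha.exists_hasEigenvector
  refine ⟨a, ?_, g, g.2, fun h0 => hg.2 (Subtype.ext h0), congrArg Subtype.val hg.apply_eq_smul⟩
  rw [Module.End.hasEigenvalue_iff_mem_spectrum, spectrum.mem_iff] at ha ⊢
  refine mt (isUnit_of_surjective_of_comp_eq Φ.surjective_rangeRestrict ?_) ha
  ext v
  simpa using DFunLike.congr_fun h v

lemma exists_isRoot_charpoly_of_apply_eq_sum {F ι P : Type*} [Field F] [IsAlgClosed F] [Fintype ι]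
    [DecidableEq ι] [AddCommGroup P] [Module F P] {T : Module.End F P} {M : Matrix ι ι F}
    {φ : ι → P} (hT : ∀ j, T (φ j) = ∑ i, M i j • φ i) (hφ : φ ≠ 0) :
    ∃ a, M.charpoly.IsRoot a ∧ ∃ g ∈ Submodule.span F (Set.range φ), g ≠ 0 ∧ T g = a • g := by
  have hcomp : T ∘ₗ Fintype.linearCombination F φ =
      Fintype.linearCombination F φ ∘ₗ Matrix.toLin' M := by
    ext j
    simp [hT, Fintype.linearCombination_apply]
  obtain ⟨a, ha, g, hg⟩ := exists_hasEigenvalue_of_comp_eq hcomp fun h0 => hφ <| funext fun j => by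
    simpa using DFunLike.congr_fun h0 (Pi.single j 1)
  rw [Module.End.hasEigenvalue_iff_isRoot_charpoly, Matrix.charpoly_toLin'] at ha
  exact ⟨a, ha, g, Fintype.range_linearCombination F φ ▸ hg⟩

variable {K : Type*} [Field K] {n : ℕ}

/-- The homogeneous polynomials of degree `k`, as a subspace of the formal functions. -/
def homogeneousFuns (K : Type*) [Field K] (n k : ℕ) : Submodule K (Fun K n) :=
  (homogeneousComponent k).eqLocus LinearMap.id

/-- The formal functions of order at least `k`, that is, without monomials of degree below `k`. -/
def orderGEFuns (K : Type*) [Field K] (n k : ℕ) : Submodule K (Fun K n) where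
  carrier := {f | (k : ℕ∞) ≤ f.order}
  add_mem' hf hg := (le_min hf hg).trans min_order_le_add
  zero_mem' := by simp
  smul_mem' _ _ hf := hf.trans le_order_smul

lemma mem_homogeneousFuns_iff {k : ℕ} {f : Fun K n} :
    f ∈ homogeneousFuns K n k ↔ f.IsHomogeneous k :=
  eq_comm.trans isHomogeneous_iff_eq_homogeneousComponent.symm

lemma mem_homogeneousFuns_iff_coeff {k : ℕ} {f : Fun K n} :
    f ∈ homogeneousFuns K n k ↔ ∀ d : Fin n →₀ ℕ, d.degree ≠ k → coeff d f = 0 := by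
  refine ⟨fun hf _ => IsHomogeneous.coeff_eq_zero (mem_homogeneousFuns_iff.1 hf), fun h => ?_⟩
  ext d
  rw [coeff_homogeneousComponent]
  split_ifs with hd
  · rfl
  · exact (h d hd).symm

lemma mem_orderGEFuns_iff {k : ℕ} {f : Fun K n} :
    f ∈ orderGEFuns K n k ↔ ∀ d : Fin n →₀ ℕ, d.degree < k → coeff d f = 0 :=
  ⟨fun hf _ hd => coeff_of_lt_order (lt_of_lt_of_le (by exact_mod_cast hd) hf), nat_le_order⟩

lemma pderiv_mem_homogeneousFuns {k : ℕ} {f : Fun K n} (hf : f ∈ homogeneousFuns K n (k + 1))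
    (i : Fin n) : pderiv K i f ∈ homogeneousFuns K n k := by
  rw [mem_homogeneousFuns_iff_coeff] at *
  intro d hd
  rw [coeff_pderiv, hf _ (by simpa using hd), zero_mul]

lemma pderiv_mem_orderGEFuns {k : ℕ} {f : Fun K n} (hf : f ∈ orderGEFuns K n k) (i : Fin n) :
    pderiv K i f ∈ orderGEFuns K n (k - 1) := by
  rw [mem_orderGEFuns_iff] at *
  intro d hd
  rw [coeff_pderiv, hf _ (by simpa using Nat.add_lt_of_lt_sub hd), zero_mul]

lemma pderiv_eq_zero_of_mem_homogeneousFuns_zero {f : Fun K n} (hf : f ∈ homogeneousFuns K n 0)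
    (i : Fin n) : pderiv K i f = 0 := by
  ext d
  rw [coeff_pderiv, mem_homogeneousFuns_iff_coeff.1 hf _ (by simp), zero_mul, coeff_zero]

lemma exists_pderiv_ne_zero [CharZero K] {k : ℕ} {f : Fun K n}
    (hf : f ∈ homogeneousFuns K n (k + 1)) (h0 : f ≠ 0) : ∃ i, pderiv K i f ≠ 0 := by
  by_contra! h
  refine h0 (pderiv.ext (fun i => by rw [h, map_zero]) ?_)
  rw [← coeff_zero_eq_constantCoeff_apply, map_zero]
  exact mem_homogeneousFuns_iff_coeff.1 hf _ (by simp)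

lemma pderiv_comm (i j : Fin n) (f : Fun K n) :
    pderiv K i (pderiv K j f) = pderiv K j (pderiv K i f) := by
  ext d
  rcases eq_or_ne i j with rfl | h
  · rfl
  · simp [coeff_pderiv, add_right_comm d, h, h.symm, mul_right_comm]

/-- The derivation `f ↦ ∑ i, Xᵢ ∂f/∂xᵢ` of the formal functions defined by the formal vector
field `X`. -/
def lieDer (X : VF K n) : Derivation K (Fun K n) (Fun K n) := ∑ i, X i • pderiv K i

lemma lieDer_apply (X : VF K n) (f : Fun K n) : lieDer X f = ∑ i, X i * pderiv K i f := by
  change Derivation.coeFnAddMonoidHom (lieDer X) f = _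
  simp [lieDer]

lemma bracket_eq_lieDer_sub (Z X : VF K n) (j : Fin n) :
    bracket Z X j = lieDer Z (X j) - lieDer X (Z j) := by
  simp [bracket, lieDer_apply]

lemma lieDer_pderiv (X : VF K n) (j : Fin n) (f : Fun K n) :
    lieDer X (pderiv K j f) =
      pderiv K j (lieDer X f) - ∑ i, pderiv K j (X i) * pderiv K i f := by
  simp only [lieDer_apply, map_sum, ← Finset.sum_sub_distrib, Derivation.leibniz, smul_eq_mul,
    pderiv_comm j]
  exact Finset.sum_congr rfl fun i _ => by ring

lemma map_lieDer {F : Type*} [Field F] (σ : K →+* F) (X : VF K n) (f : Fun K n) :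
    map σ (lieDer X f) = lieDer (fun j => map σ (X j)) (map σ f) := by
  have hpderiv (i : Fin n) : map σ (pderiv K i f) = pderiv F i (map σ f) := by
    ext d
    simp [coeff_pderiv]
  simp [lieDer_apply, hpderiv]

lemma map_linearField {F : Type*} [Field F] (σ : K →+* F) (A : Matrix (Fin n) (Fin n) K)
    (j : Fin n) : map σ (linearField A j) = linearField (A.map σ) j := by
  simp [linearField, smul_eq_C_mul]

lemma linearField_mem_homogeneousFuns (A : Matrix (Fin n) (Fin n) K) (j : Fin n) :
    linearField A j ∈ homogeneousFuns K n 1 := by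
  classical
  refine Submodule.sum_mem _ fun i _ => Submodule.smul_mem _ _ (mem_homogeneousFuns_iff_coeff.2 ?_)
  intro d hd
  rw [coeff_X, if_neg]
  rintro rfl
  simp at hd

lemma pderiv_linearField (A : Matrix (Fin n) (Fin n) K) (i j : Fin n) :
    pderiv K i (linearField A j) = C (A j i) := by
  simp [linearField, pderiv_X, Pi.single_apply, smul_eq_C_mul]

lemma lieDer_linearField_mem_homogeneousFuns (A : Matrix (Fin n) (Fin n) K) {k : ℕ} {f : Fun K n}
    (hf : f ∈ homogeneousFuns K n k) : lieDer (linearField A) f ∈ homogeneousFuns K n k := by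
  rw [lieDer_apply]
  refine Submodule.sum_mem _ fun i _ => ?_
  cases k with
  | zero =>
    rw [pderiv_eq_zero_of_mem_homogeneousFuns_zero hf, mul_zero]
    exact Submodule.zero_mem _
  | succ k =>
    rw [add_comm]
    exact mem_homogeneousFuns_iff.2 <|
      IsHomogeneous.mul (mem_homogeneousFuns_iff.1 (linearField_mem_homogeneousFuns A i))
        (mem_homogeneousFuns_iff.1 (pderiv_mem_homogeneousFuns hf i))

lemma lieDer_linearField_pderiv (A : Matrix (Fin n) (Fin n) K) (j : Fin n) (f : Fun K n) :
    lieDer (linearField A) (pderiv K j f) =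
      pderiv K j (lieDer (linearField A) f) - ∑ i, A i j • pderiv K i f := by
  simp only [lieDer_pderiv, pderiv_linearField, smul_eq_C_mul]

lemma lieDer_linearField_apply (X : VF K n) (A : Matrix (Fin n) (Fin n) K) (j : Fin n) :
    lieDer X (linearField A j) = ∑ i, A j i • X i := by
  simp only [lieDer_apply, pderiv_linearField, smul_eq_C_mul, mul_comm]

lemma bracket_linearField (Z : VF K n) (A : Matrix (Fin n) (Fin n) K) (j : Fin n) :
    bracket Z (linearField A) j = ∑ i, A j i • Z i - lieDer (linearField A) (Z j) := by
  rw [bracket_eq_lieDer_sub, lieDer_linearField_apply]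

/-- The first-order partial derivatives of an eigenfunction span a space on which the derivation
acts as `a - A`, so that differentiating splits off an eigenvalue of `A`. -/
lemma exists_multiset_sum_eq_of_lieDer_eq_smul {F : Type*} [Field F] [IsAlgClosed F] [CharZero F]
    (A : Matrix (Fin n) (Fin n) F) {k : ℕ} {f : Fun F n} {a : F} (hf : f ∈ homogeneousFuns F n k)
    (h0 : f ≠ 0) (h : lieDer (linearField A) f = a • f) :
    ∃ s : Multiset F, (∀ b ∈ s, A.charpoly.IsRoot b) ∧ Multiset.card s = k ∧ s.sum = a := by
  induction k generalizing f a with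
  | zero =>
    simp only [lieDer_apply, pderiv_eq_zero_of_mem_homogeneousFuns_zero hf, mul_zero,
      Finset.sum_const_zero] at h
    exact ⟨0, by simp, rfl, ((smul_eq_zero.1 h.symm).resolve_right h0).symm⟩
  | succ k ih =>
    let T : Module.End F (Fun F n) := a • 1 - (lieDer (linearField A)).toLinearMap
    have hT (j : Fin n) : T (pderiv F j f) = ∑ i, A i j • pderiv F i f := by
      simp [T, lieDer_linearField_pderiv, h]
    obtain ⟨b, hb, g, hg, hg0, hgb⟩ := exists_isRoot_charpoly_of_apply_eq_sum hT
      (Function.ne_iff.2 (exists_pderiv_ne_zero hf h0))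
    have hgk : g ∈ homogeneousFuns F n k :=
      Submodule.span_le.2 (Set.range_subset_iff.2 (pderiv_mem_homogeneousFuns hf)) hg
    have hgab : lieDer (linearField A) g = (a - b) • g := by
      rw [sub_smul, ← hgb]
      simp [T]
    obtain ⟨s, hs, hsk, hsum⟩ := ih hgk hg0 hgab
    exact ⟨b ::ₘ s, Multiset.forall_mem_cons.2 ⟨hb, hs⟩, by simp [hsk], by simp [hsum]⟩

lemma mem_eigenvalues_iff {A : Matrix (Fin n) (Fin n) K} {a : AlgebraicClosure K} :
    a ∈ eigenvalues A ↔ (A.map (algebraMap K (AlgebraicClosure K))).charpoly.IsRoot a := by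
  rw [Matrix.charpoly_map]
  exact Polynomial.mem_roots (A.charpoly_monic.map _).ne_zero

lemma NonResonant.zero_notMem_eigenvalues {A : Matrix (Fin n) (Fin n) K} (hA : NonResonant A) :
    0 ∉ eigenvalues A :=
  fun h => hA 0 h {0, 0} (by simpa using h) (by simp) (by simp)

lemma exists_multiset_sum_mem_eigenvalues [CharZero K] {A : Matrix (Fin n) (Fin n) K} {k : ℕ}
    {Z : VF K n} (hZ : ∀ j, Z j ∈ homogeneousFuns K n k) (h0 : Z ≠ 0)
    (h : bracket Z (linearField A) = 0) :
    ∃ s : Multiset (AlgebraicClosure K),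
      (∀ b ∈ s, b ∈ eigenvalues A) ∧ Multiset.card s = k ∧ s.sum ∈ eigenvalues A := by
  let σ := algebraMap K (AlgebraicClosure K)
  have : CharZero (AlgebraicClosure K) := charZero_of_injective_algebraMap σ.injective
  have hT (j : Fin n) : (lieDer (linearField (A.map σ))).toLinearMap (map σ (Z j)) =
      ∑ i, (A.map σ).transpose i j • map σ (Z i) := by
    have hj : lieDer (linearField A) (Z j) = ∑ i, A j i • Z i := by
      rw [eq_comm, ← sub_eq_zero, ← bracket_linearField, h, Pi.zero_apply]
    simpa [map_lieDer, map_linearField, smul_eq_C_mul] using congrArg (map σ) hj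
  have hZσ : (fun j => map σ (Z j)) ≠ 0 := by
    refine fun hσ => h0 (funext fun j => MvPowerSeries.ext fun d => σ.injective ?_)
    simpa using congrArg (coeff d) (congrFun hσ j)
  obtain ⟨a, ha, g, hg, hg0, hga⟩ := exists_isRoot_charpoly_of_apply_eq_sum hT hZσ
  have hgk : g ∈ homogeneousFuns (AlgebraicClosure K) n k := by
    refine Submodule.span_le.2 (Set.range_subset_iff.2 fun j => ?_) hg
    rw [SetLike.mem_coe, mem_homogeneousFuns_iff_coeff]
    intro d hd
    rw [coeff_map, mem_homogeneousFuns_iff_coeff.1 (hZ j) d hd, map_zero]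
  obtain ⟨s, hs, hsk, hsum⟩ := exists_multiset_sum_eq_of_lieDer_eq_smul _ hgk hg0 hga
  rw [Matrix.charpoly_transpose] at ha
  exact ⟨s, fun b hb => mem_eigenvalues_iff.2 (hs b hb), hsk, mem_eigenvalues_iff.2 (hsum ▸ ha)⟩

lemma eq_zero_of_bracket_linearField_eq_zero [CharZero K] {A : Matrix (Fin n) (Fin n) K}
    (hA : NonResonant A) {k : ℕ} (hk : k ≠ 1) {Z : VF K n}
    (hZ : ∀ j, Z j ∈ homogeneousFuns K n k) (h : bracket Z (linearField A) = 0) : Z = 0 := by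
  by_contra h0
  obtain ⟨s, hs, rfl, hsum⟩ := exists_multiset_sum_mem_eigenvalues hZ h0 h
  rcases s.empty_or_exists_mem with rfl | ⟨a, ha⟩
  · exact hA.zero_notMem_eigenvalues hsum
  · have : Multiset.card s ≠ 0 := (Multiset.card_pos_iff_exists_mem.2 ⟨a, ha⟩).ne'
    exact hA _ hsum s hs (by omega) rfl

end Graded

/-! ### The homological equation -/

section Solve

open MvPowerSeries

variable {K : Type*} [Field K] {n : ℕ}

/-- The homogeneous vector fields of degree `k`. -/
def homogeneousFields (K : Type*) [Field K] (n k : ℕ) : Submodule K (VF K n) :=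
  Submodule.pi Set.univ fun _ => homogeneousFuns K n k

/-- The formal vector fields of order at least `k`: the filtration along which equations between
formal vector fields are solved degree by degree. -/
def orderGEFields (K : Type*) [Field K] (n k : ℕ) : Submodule K (VF K n) :=
  Submodule.pi Set.univ fun _ => orderGEFuns K n k

/-- The homogeneous component of degree `k` of a formal vector field. -/
def fieldComponent (k : ℕ) : VF K n →ₗ[K] VF K n :=
  (homogeneousComponent k).compLeft (Fin n)

lemma mem_homogeneousFields_iff {k : ℕ} {Z : VF K n} :
    Z ∈ homogeneousFields K n k ↔ ∀ j, Z j ∈ homogeneousFuns K n k := by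
  simp [homogeneousFields]

lemma mem_orderGEFields_iff {k : ℕ} {Z : VF K n} :
    Z ∈ orderGEFields K n k ↔ ∀ j, Z j ∈ orderGEFuns K n k := by
  simp [orderGEFields]

lemma mem_orderGEFields_iff_coeff {k : ℕ} {Z : VF K n} :
    Z ∈ orderGEFields K n k ↔ ∀ j, ∀ d : Fin n →₀ ℕ, d.degree < k → coeff d (Z j) = 0 := by
  simp only [mem_orderGEFields_iff, mem_orderGEFuns_iff]

lemma mem_orderGEFields_zero (Z : VF K n) : Z ∈ orderGEFields K n 0 :=
  mem_orderGEFields_iff_coeff.2 fun _ _ hd => absurd hd (Nat.not_lt_zero _)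

lemma mem_orderGEFields_one_iff {X : VF K n} :
    X ∈ orderGEFields K n 1 ↔ ∀ j, constantCoeff (X j) = 0 :=
  mem_orderGEFields_iff.trans <| forall_congr' fun _ => one_le_order_iff_constCoeff_eq_zero

lemma orderGEFields_antitone : Antitone (orderGEFields K n) := by
  intro k l hkl Z hZ
  rw [mem_orderGEFields_iff_coeff] at *
  exact fun j d hd => hZ j d (hd.trans_le hkl)

lemma coeff_fieldComponent (k : ℕ) (Z : VF K n) (j : Fin n) (d : Fin n →₀ ℕ) :
    coeff d (fieldComponent k Z j) = if d.degree = k then coeff d (Z j) else 0 :=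
  coeff_homogeneousComponent k d (Z j)

lemma fieldComponent_mem (k : ℕ) (Z : VF K n) : fieldComponent k Z ∈ homogeneousFields K n k :=
  mem_homogeneousFields_iff.2 fun j =>
    mem_homogeneousFuns_iff.2 (isHomogeneous_homogeneousComponent (Z j) k)

lemma fieldComponent_eq_self {k : ℕ} {Z : VF K n} (hZ : Z ∈ homogeneousFields K n k) :
    fieldComponent k Z = Z :=
  funext (mem_homogeneousFields_iff.1 hZ)

lemma homogeneousFields_le_orderGEFields (k : ℕ) :
    homogeneousFields K n k ≤ orderGEFields K n k := by
  intro Z hZ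
  simp only [mem_homogeneousFields_iff, mem_homogeneousFuns_iff_coeff] at hZ
  exact mem_orderGEFields_iff_coeff.2 fun j d hd => hZ j d hd.ne

lemma fieldComponent_eq_zero_iff {k : ℕ} {Z : VF K n} (hZ : Z ∈ orderGEFields K n k) :
    fieldComponent k Z = 0 ↔ Z ∈ orderGEFields K n (k + 1) := by
  rw [mem_orderGEFields_iff_coeff] at *
  refine ⟨fun h j d hd => ?_, fun h => funext fun j => MvPowerSeries.ext fun d => ?_⟩
  · rcases (Nat.lt_succ_iff.1 hd).lt_or_eq with hlt | heq
    · exact hZ j d hlt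
    · simpa [coeff_fieldComponent, heq] using congrArg (coeff d) (congrFun h j)
  · rw [coeff_fieldComponent]
    split_ifs with hd
    · exact h j d (hd.trans_lt k.lt_succ_self)
    · simp

lemma sub_fieldComponent_mem {k : ℕ} {Z : VF K n} (hZ : Z ∈ orderGEFields K n k) :
    Z - fieldComponent k Z ∈ orderGEFields K n (k + 1) := by
  have hcomp := fieldComponent_mem k Z
  refine (fieldComponent_eq_zero_iff <|
    Submodule.sub_mem _ hZ (homogeneousFields_le_orderGEFields k hcomp)).1 ?_
  rw [map_sub, fieldComponent_eq_self hcomp, sub_self]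

lemma eq_zero_of_forall_mem_orderGEFields {Z : VF K n} (h : ∀ k, Z ∈ orderGEFields K n k) :
    Z = 0 :=
  funext fun j => MvPowerSeries.ext fun d =>
    mem_orderGEFields_iff_coeff.1 (h (d.degree + 1)) j d d.degree.lt_succ_self

lemma exists_forall_sub_mem_orderGEFields {W : ℕ → VF K n}
    (hW : ∀ k, W (k + 1) - W k ∈ orderGEFields K n k) :
    ∃ Z, ∀ k, Z - W k ∈ orderGEFields K n k := by
  have hstab {k l : ℕ} (hkl : k ≤ l) : W l - W k ∈ orderGEFields K n k := by
    induction l, hkl using Nat.le_induction with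
    | base => simp
    | succ l hkl ih =>
      rw [← sub_add_sub_cancel]
      exact Submodule.add_mem _ (orderGEFields_antitone hkl (hW l)) ih
  let Z : VF K n := fun j d => coeff d (W (d.degree + 1) j)
  refine ⟨Z, fun k => mem_orderGEFields_iff_coeff.2 fun j d hd => ?_⟩
  rw [← neg_sub, Pi.neg_apply, map_neg, neg_eq_zero]
  exact mem_orderGEFields_iff_coeff.1 (hstab (Nat.succ_le_of_lt hd)) j d d.degree.lt_succ_self

lemma exists_apply_eq_of_forall_exists_sub_mem {L : VF K n →ₗ[K] VF K n}
    (hL : ∀ k, orderGEFields K n k ≤ (orderGEFields K n k).comap L) {m : ℕ}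
    (happrox : ∀ k ≥ m, ∀ Y ∈ orderGEFields K n k,
      ∃ Z ∈ orderGEFields K n k, Y - L Z ∈ orderGEFields K n (k + 1))
    {Y : VF K n} (hY : Y ∈ orderGEFields K n m) : ∃ Z, L Z = Y := by
  have hnext (k : ℕ) (W : VF K n) (hW : Y - L W ∈ orderGEFields K n (m + k)) :
      ∃ W', W' - W ∈ orderGEFields K n (m + k) ∧ Y - L W' ∈ orderGEFields K n (m + (k + 1)) := by
    obtain ⟨Z, hZ, hres⟩ := happrox (m + k) (Nat.le_add_right m k) _ hW
    exact ⟨W + Z, by simpa using hZ, by rwa [map_add, ← sub_sub]⟩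
  choose! next hdiff hres using hnext
  let W : ℕ → VF K n := Nat.rec 0 next
  have hW (k : ℕ) : Y - L (W k) ∈ orderGEFields K n (m + k) := by
    induction k with
    | zero => simpa [W] using hY
    | succ k ih => exact hres k _ ih
  obtain ⟨Z, hZ⟩ := exists_forall_sub_mem_orderGEFields (W := W) fun k =>
    orderGEFields_antitone (Nat.le_add_left k m) (hdiff k _ (hW k))
  refine ⟨Z, sub_eq_zero.1 (eq_zero_of_forall_mem_orderGEFields fun k => ?_)⟩
  have hLZ : L Z - Y = L (Z - W k) - (Y - L (W k)) := by
    rw [map_sub]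
    abel
  rw [hLZ]
  exact Submodule.sub_mem _ (hL k (hZ k)) (orderGEFields_antitone (Nat.le_add_left k m) (hW k))

lemma linearField_mem_homogeneousFields (A : Matrix (Fin n) (Fin n) K) :
    linearField A ∈ homogeneousFields K n 1 :=
  mem_homogeneousFields_iff.2 (linearField_mem_homogeneousFuns A)

lemma linearField_mem_orderGEFields (A : Matrix (Fin n) (Fin n) K) :
    linearField A ∈ orderGEFields K n 1 :=
  homogeneousFields_le_orderGEFields 1 (linearField_mem_homogeneousFields A)

lemma linearMatrix_linearField (A : Matrix (Fin n) (Fin n) K) :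
    linearMatrix (linearField A) = A := by
  classical
  ext j i
  simp [linearMatrix, linearField, coeff_X, Finsupp.single_left_inj]

lemma fieldComponent_one (X : VF K n) : fieldComponent 1 X = linearPart X := by
  funext j
  ext d
  by_cases hd : d.degree = 1
  · obtain ⟨i, rfl⟩ := (Finsupp.range_single_one (σ := Fin n)).symm.subset hd
    rw [coeff_fieldComponent, if_pos hd]
    exact (congrFun₂ (linearMatrix_linearField (linearMatrix X)) j i).symm
  · rw [coeff_fieldComponent, if_neg hd]
    exact (mem_homogeneousFuns_iff_coeff.1 (linearField_mem_homogeneousFuns _ j) d hd).symm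

lemma lieDer_mem_orderGEFuns {a b c : ℕ} {X : VF K n} {f : Fun K n}
    (hX : X ∈ orderGEFields K n a) (hf : f ∈ orderGEFuns K n b) (h : c + 1 ≤ a + b) :
    lieDer X f ∈ orderGEFuns K n c := by
  rw [lieDer_apply]
  refine Submodule.sum_mem _ fun i _ => le_trans ?_ <|
    (add_le_add (mem_orderGEFields_iff.1 hX i) (pderiv_mem_orderGEFuns hf i)).trans le_order_mul
  exact_mod_cast (by omega : c ≤ a + (b - 1))

/-- The bracket with a fixed formal vector field, as a linear map. -/
def bracketHom (X : VF K n) : VF K n →ₗ[K] VF K n where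
  toFun Z := bracket Z X
  map_add' Z W := by
    funext j
    simp only [bracket_eq_lieDer_sub, lieDer, Pi.add_apply, add_smul, Finset.sum_add_distrib]
    simp only [map_add, Derivation.add_apply]
    abel
  map_smul' c Z := by
    funext j
    simp [bracket, Finset.smul_sum, smul_sub]

lemma bracket_sub_right (Z X Y : VF K n) : bracket Z (X - Y) = bracket Z X - bracket Z Y := by
  funext j
  simp only [bracket, Pi.sub_apply, map_sub, ← Finset.sum_sub_distrib]
  exact Finset.sum_congr rfl fun i _ => by ring

lemma bracket_mem_orderGEFields {a b c : ℕ} {Z X : VF K n} (hZ : Z ∈ orderGEFields K n a)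
    (hX : X ∈ orderGEFields K n b) (h : c + 1 ≤ a + b) : bracket Z X ∈ orderGEFields K n c := by
  rw [mem_orderGEFields_iff] at *
  intro j
  rw [bracket_eq_lieDer_sub]
  exact Submodule.sub_mem _ (lieDer_mem_orderGEFuns (mem_orderGEFields_iff.2 hZ) (hX j) h)
    (lieDer_mem_orderGEFuns (mem_orderGEFields_iff.2 hX) (hZ j) (add_comm a b ▸ h))

/-- The linear vector field of a matrix, as a linear map. -/
def linearFieldHom (K : Type*) [Field K] (n : ℕ) : Matrix (Fin n) (Fin n) K →ₗ[K] VF K n where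
  toFun := linearField
  map_add' A B := by
    funext j
    simp [linearField, add_smul, Finset.sum_add_distrib]
  map_smul' c A := by
    funext j
    simp [linearField, Finset.smul_sum, smul_smul]

lemma linearField_mul (A B : Matrix (Fin n) (Fin n) K) (j : Fin n) :
    linearField (A * B) j = ∑ i, A j i • linearField B i := by
  simp only [linearField, Matrix.mul_apply, Finset.smul_sum, Finset.sum_smul, smul_smul]
  exact Finset.sum_comm

lemma bracket_linearField_linearField (B A : Matrix (Fin n) (Fin n) K) :
    bracket (linearField B) (linearField A) = linearField (intertwining K A A B) := by
  funext j
  rw [bracket_linearField, lieDer_linearField_apply, ← linearField_mul, ← linearField_mul]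
  exact congrFun (map_sub (linearFieldHom K n) (A * B) (B * A)).symm j

lemma bracket_linearField_mem_homogeneousFields (A : Matrix (Fin n) (Fin n) K) {k : ℕ}
    {Z : VF K n} (hZ : Z ∈ homogeneousFields K n k) :
    bracket Z (linearField A) ∈ homogeneousFields K n k := by
  rw [mem_homogeneousFields_iff] at *
  intro j
  rw [bracket_linearField]
  exact Submodule.sub_mem _ (Submodule.sum_mem _ fun i _ => Submodule.smul_mem _ _ (hZ i))
    (lieDer_linearField_mem_homogeneousFuns A (hZ j))

instance finiteDimensional_homogeneousFields (k : ℕ) :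
    FiniteDimensional K (homogeneousFields K n k) := by
  have : Finite {d : Fin n →₀ ℕ // d.degree = k} := (Finsupp.finite_of_degree_eq k).to_subtype
  let Φ : homogeneousFields K n k →ₗ[K] Fin n → {d : Fin n →₀ ℕ // d.degree = k} → K :=
    LinearMap.pi fun j => LinearMap.pi fun d =>
      coeff d.1 ∘ₗ LinearMap.proj j ∘ₗ (homogeneousFields K n k).subtype
  refine FiniteDimensional.of_injective Φ ((injective_iff_map_eq_zero Φ).2 fun Z hZ => ?_)
  ext j d
  by_cases hd : d.degree = k
  · exact congrFun₂ hZ j ⟨d, hd⟩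
  · exact mem_homogeneousFuns_iff_coeff.1 (mem_homogeneousFields_iff.1 Z.2 j) d hd

lemma sub_linearPart_mem_orderGEFields_two {X : VF K n} (hX : X ∈ orderGEFields K n 1) :
    X - linearPart X ∈ orderGEFields K n 2 :=
  fieldComponent_one X ▸ sub_fieldComponent_mem hX

lemma bracket_sub_bracket_linearPart_mem {X Z : VF K n} (hX : X ∈ orderGEFields K n 1) {k : ℕ}
    (hZ : Z ∈ orderGEFields K n k) :
    bracket Z X - bracket (fieldComponent k Z) (linearPart X) ∈ orderGEFields K n (k + 1) := by
  have hsplit : bracket Z X - bracket (fieldComponent k Z) (linearPart X) =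
      bracket (Z - fieldComponent k Z) X + bracket (fieldComponent k Z) (X - linearPart X) := by
    rw [bracket_sub_right, ← sub_add_sub_cancel _ (bracket (fieldComponent k Z) X)]
    exact congrArg (· + _) (map_sub (bracketHom X) _ _).symm
  have hcomp := homogeneousFields_le_orderGEFields k (fieldComponent_mem k Z)
  rw [hsplit]
  exact Submodule.add_mem _
    (bracket_mem_orderGEFields (sub_fieldComponent_mem hZ) hX le_rfl)
    (bracket_mem_orderGEFields hcomp (sub_linearPart_mem_orderGEFields_two hX) le_rfl)

lemma fieldComponent_bracket {X Z : VF K n} (hX : X ∈ orderGEFields K n 1) {k : ℕ}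
    (hZ : Z ∈ orderGEFields K n k) :
    fieldComponent k (bracket Z X) = bracket (fieldComponent k Z) (linearPart X) := by
  have hcomp := bracket_linearField_mem_homogeneousFields (linearMatrix X) (fieldComponent_mem k Z)
  rw [← linearPart] at hcomp
  rw [← sub_eq_zero, ← fieldComponent_eq_self hcomp, ← map_sub]
  refine (fieldComponent_eq_zero_iff (Submodule.sub_mem _ ?_ ?_)).2
    (bracket_sub_bracket_linearPart_mem hX hZ)
  · exact bracket_mem_orderGEFields hZ hX le_rfl
  · exact homogeneousFields_le_orderGEFields k hcomp

section NonResonant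

variable [CharZero K] {X : VF K n}

lemma exists_bracket_linearField_eq {A : Matrix (Fin n) (Fin n) K} (hA : NonResonant A) {k : ℕ}
    (hk : k ≠ 1) {Y : VF K n} (hY : Y ∈ homogeneousFields K n k) :
    ∃ Z ∈ homogeneousFields K n k, bracket Z (linearField A) = Y := by
  let T : Module.End K (homogeneousFields K n k) :=
    (bracketHom (linearField A)).restrict fun _ => bracket_linearField_mem_homogeneousFields A
  have hT : Function.Injective T := (injective_iff_map_eq_zero T).2 fun Z hZ => Subtype.ext <|
    eq_zero_of_bracket_linearField_eq_zero hA hk (mem_homogeneousFields_iff.1 Z.2)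
      (congrArg Subtype.val hZ)
  obtain ⟨Z, hZ⟩ := LinearMap.injective_iff_surjective.1 hT ⟨Y, hY⟩
  exact ⟨Z, Z.2, congrArg Subtype.val hZ⟩

lemma exists_sub_bracket_mem_orderGEFields (hX : X ∈ orderGEFields K n 1)
    (hres : NonResonant (linearMatrix X)) {k : ℕ} (hk : k ≠ 1) {Y : VF K n}
    (hY : Y ∈ orderGEFields K n k) :
    ∃ Z ∈ orderGEFields K n k, Y - bracket Z X ∈ orderGEFields K n (k + 1) := by
  obtain ⟨Z, hZ, hZY⟩ := exists_bracket_linearField_eq hres hk (fieldComponent_mem k Y)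
  have hZk := homogeneousFields_le_orderGEFields k hZ
  refine ⟨Z, hZk, (fieldComponent_eq_zero_iff <|
    Submodule.sub_mem _ hY (bracket_mem_orderGEFields hZk hX le_rfl)).1 ?_⟩
  rw [map_sub, fieldComponent_bracket hX hZk, fieldComponent_eq_self hZ, linearPart, hZY, sub_self]

lemma orderGEFields_two_le_trivialDefs (hX : X ∈ orderGEFields K n 1)
    (hres : NonResonant (linearMatrix X)) : orderGEFields K n 2 ≤ trivialDefs X := by
  intro Y hY
  have hL (k : ℕ) : orderGEFields K n k ≤ (orderGEFields K n k).comap (bracketHom X) :=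
    fun Z hZ => bracket_mem_orderGEFields hZ hX le_rfl
  obtain ⟨Z, hZ⟩ := exists_apply_eq_of_forall_exists_sub_mem hL
    (fun k hk _ => exists_sub_bracket_mem_orderGEFields hX hres (by omega : k ≠ 1)) hY
  exact ⟨Z, hZ.symm⟩

lemma range_linearFieldHom_sup_trivialDefs (hX : X ∈ orderGEFields K n 1)
    (hres : NonResonant (linearMatrix X)) :
    (linearFieldHom K n).range ⊔ trivialDefs X = ⊤ := by
  refine eq_top_iff.2 fun Y _ => ?_
  obtain ⟨Z, -, hZ⟩ :=
    exists_sub_bracket_mem_orderGEFields hX hres zero_ne_one (mem_orderGEFields_zero Y)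
  have hY : Y = linearPart (Y - bracket Z X) +
      (Y - bracket Z X - linearPart (Y - bracket Z X) + bracket Z X) := by abel
  rw [hY]
  exact Submodule.add_mem_sup ⟨_, rfl⟩ <| Submodule.add_mem _
    (orderGEFields_two_le_trivialDefs hX hres (sub_linearPart_mem_orderGEFields_two hZ)) ⟨Z, rfl⟩

lemma comap_linearFieldHom_trivialDefs (hX : X ∈ orderGEFields K n 1)
    (hres : NonResonant (linearMatrix X)) :
    (trivialDefs X).comap (linearFieldHom K n) =
      (intertwining K (linearMatrix X) (linearMatrix X)).range := by
  ext M
  constructor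
  · rintro ⟨Z, hZ : linearField M = bracket Z X⟩
    have hZ0 : fieldComponent 0 Z = 0 := by
      refine eq_zero_of_bracket_linearField_eq_zero hres zero_ne_one
        (mem_homogeneousFields_iff.1 (fieldComponent_mem 0 Z)) ?_
      rw [← linearPart, ← fieldComponent_bracket hX (mem_orderGEFields_zero Z), ← hZ]
      exact (fieldComponent_eq_zero_iff (mem_orderGEFields_zero _)).2
        (linearField_mem_orderGEFields M)
    have hZ1 := (fieldComponent_eq_zero_iff (mem_orderGEFields_zero Z)).1 hZ0
    refine ⟨linearMatrix Z, ?_⟩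
    rw [← linearMatrix_linearField (intertwining K _ _ _), ← bracket_linearField_linearField,
      ← linearPart, ← linearPart, ← fieldComponent_one Z, ← fieldComponent_bracket hX hZ1, ← hZ,
      fieldComponent_eq_self (linearField_mem_homogeneousFields M), linearMatrix_linearField]
  · rintro ⟨B, rfl⟩
    have hdiff := orderGEFields_two_le_trivialDefs hX hres
      (bracket_sub_bracket_linearPart_mem hX (linearField_mem_orderGEFields B))
    rw [fieldComponent_eq_self (linearField_mem_homogeneousFields B), linearPart,
      bracket_linearField_linearField] at hdiff
    have hB : bracket (linearField B) X ∈ trivialDefs X := ⟨linearField B, rfl⟩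
    exact ((trivialDefs X).sub_mem_iff_right hB).1 hdiff

end NonResonant

end Solve

/-! ### Deformation cohomology of non-resonant fields -/

section Cohomology

open MvPowerSeries

/-- A linear map `f : M → V` with image in `Z` and with `Z ≤ f(M) + B` induces an isomorphism from
`M ⧸ f⁻¹(B)` onto `Z ⧸ (B ∩ Z)`. It presents each deformation space as a quotient of the space of
matrices. -/
def quotientComapEquiv {K M V : Type*} [Ring K] [AddCommGroup M] [Module K M] [AddCommGroup V]
    [Module K V] (f : M →ₗ[K] V) {N : Submodule K M} {Z B : Submodule K V} (hf : ∀ m, f m ∈ Z)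
    (hN : B.comap f = N) (hZ : Z ≤ f.range ⊔ B) : (M ⧸ N) ≃ₗ[K] Z ⧸ B.submoduleOf Z :=
  LinearEquiv.ofBijective (N.mapQ (B.submoduleOf Z) (f.codRestrict Z hf) hN.ge) <| by
    constructor
    · refine (injective_iff_map_eq_zero _).2 fun m hm => ?_
      obtain ⟨m, rfl⟩ := N.mkQ_surjective m
      have hfm : f m ∈ B := (Submodule.Quotient.mk_eq_zero (B.submoduleOf Z)).1 hm
      exact (Submodule.Quotient.mk_eq_zero N).2 (hN.le hfm)
    · intro z
      obtain ⟨⟨z, hz⟩, rfl⟩ := Submodule.mkQ_surjective _ z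
      obtain ⟨_, ⟨m, rfl⟩, b, hb, rfl⟩ := Submodule.mem_sup.1 (hZ hz)
      refine ⟨N.mkQ m, (Submodule.Quotient.eq _).2 ?_⟩
      simpa [Submodule.submoduleOf] using hb

variable {K : Type*} [Field K] {n : ℕ}

lemma linearFields_eq_range : linearFields K n = (linearFieldHom K n).range :=
  SetLike.ext fun _ => exists_congr fun _ => eq_comm

lemma trivialDefs_le_trivialFolDefs (X : VF K n) : trivialDefs X ≤ trivialFolDefs X := by
  rintro _ ⟨Z, rfl⟩
  exact ⟨Z, 0, by simp⟩

lemma smul_mem_orderGEFields {f : Fun K n} {X : VF K n} {a b : ℕ} (hf : f ∈ orderGEFuns K n a)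
    (hX : X ∈ orderGEFields K n b) : f • X ∈ orderGEFields K n (a + b) := by
  rw [mem_orderGEFields_iff] at *
  intro j
  change ((a + b : ℕ) : ℕ∞) ≤ _
  exact_mod_cast (add_le_add hf (hX j)).trans le_order_mul

lemma smul_sub_smul_linearPart_mem {X : VF K n} (hX : X ∈ orderGEFields K n 1) (f : Fun K n) :
    f • X - constantCoeff f • linearPart X ∈ orderGEFields K n 2 := by
  have hsplit : f • X - constantCoeff f • linearPart X =
      (f - C (constantCoeff f)) • X + constantCoeff f • (X - linearPart X) := by
    funext j
    simp [smul_eq_C_mul, sub_mul, mul_sub]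
  have hf : f - C (constantCoeff f) ∈ orderGEFuns K n 1 :=
    one_le_order_iff_constCoeff_eq_zero.2 (by simp)
  rw [hsplit]
  exact Submodule.add_mem _ (smul_mem_orderGEFields hf hX)
    (Submodule.smul_mem _ _ (sub_linearPart_mem_orderGEFields_two hX))

lemma NonResonant.isUnit_det {A : Matrix (Fin n) (Fin n) K} (hA : NonResonant A) :
    IsUnit A.det := by
  refine isUnit_iff_ne_zero.2 fun hdet => hA.zero_notMem_eigenvalues (mem_eigenvalues_iff.2 ?_)
  rw [Polynomial.IsRoot, Matrix.eval_charpoly, map_zero, zero_sub, Matrix.det_neg,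
    ← RingHom.mapMatrix_apply, ← RingHom.map_det, hdet, map_zero, mul_zero]

variable [CharZero K] {X : VF K n}

lemma notMem_range_intertwining (hn : n ≠ 0) {A : Matrix (Fin n) (Fin n) K}
    (hA : IsUnit A.det) : A ∉ (intertwining K A A).range := by
  rintro ⟨B, hB⟩
  have htrace := congrArg (fun M => Matrix.trace (M * A⁻¹)) hB
  simp only [intertwining_apply, sub_mul, Matrix.mul_nonsing_inv _ hA, mul_assoc, mul_one,
    Matrix.trace_sub, Matrix.trace_one, Fintype.card_fin] at htrace
  rw [Matrix.trace_mul_comm, mul_assoc, Matrix.nonsing_inv_mul _ hA, mul_one, sub_self] at htrace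
  exact Nat.cast_ne_zero.2 hn htrace.symm

lemma trivialFolDefs_eq_sup (hX : X ∈ orderGEFields K n 1)
    (hres : NonResonant (linearMatrix X)) :
    trivialFolDefs X = trivialDefs X ⊔ Submodule.span K {linearPart X} := by
  have h2 := orderGEFields_two_le_trivialDefs hX hres
  have hle := trivialDefs_le_trivialFolDefs X
  apply le_antisymm
  · rintro _ ⟨Z, f, rfl⟩
    rw [← sub_add_cancel (f • X) (constantCoeff f • linearPart X), ← add_assoc]
    exact Submodule.add_mem_sup
      (Submodule.add_mem _ ⟨Z, rfl⟩ (h2 (smul_sub_smul_linearPart_mem hX f)))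
      (Submodule.smul_mem _ _ (Submodule.mem_span_singleton_self _))
  · refine sup_le hle ((Submodule.span_singleton_le_iff_mem _ _).2 ?_)
    have hbracket : bracket 0 X = 0 := map_zero (bracketHom X)
    have hmem : X ∈ trivialFolDefs X := ⟨0, 1, by rw [hbracket, one_smul, zero_add]⟩
    exact (Submodule.sub_mem_iff_right _ hmem).1
      (hle (h2 (sub_linearPart_mem_orderGEFields_two hX)))

lemma comap_linearFieldHom_trivialFolDefs (hX : X ∈ orderGEFields K n 1)
    (hres : NonResonant (linearMatrix X)) :
    (trivialFolDefs X).comap (linearFieldHom K n) =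
      (intertwining K (linearMatrix X) (linearMatrix X)).range ⊔
        Submodule.span K {linearMatrix X} := by
  have hcomap := comap_linearFieldHom_trivialDefs hX hres
  rw [← Submodule.comap_map_sup_of_comap_le (hcomap.le.trans le_sup_left), Submodule.map_sup,
    ← hcomap, Submodule.map_span, Set.image_singleton, sup_right_comm,
    sup_of_le_right (Submodule.map_comap_le (linearFieldHom K n) (trivialDefs X)),
    trivialFolDefs_eq_sup hX hres]
  rfl

lemma comap_linearFieldHom_trivialDefs_inf_linearFields {A : Matrix (Fin n) (Fin n) K}
    (hA : NonResonant A) :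
    (trivialDefs (linearField A) ⊓ linearFields K n).comap (linearFieldHom K n) =
      (intertwining K A A).range := by
  have hcomap := comap_linearFieldHom_trivialDefs (linearField_mem_orderGEFields A)
    (by rwa [linearMatrix_linearField])
  rw [Submodule.comap_inf, inf_of_le_left fun M _ => ⟨M, rfl⟩, hcomap, linearMatrix_linearField]

/-- The linear deformation cohomology of a non-resonant linear field, presented as the cokernel of
`ad A`. -/
def dhLinEquiv {A : Matrix (Fin n) (Fin n) K} (hA : NonResonant A) :
    (Matrix (Fin n) (Fin n) K ⧸ (intertwining K A A).range) ≃ₗ[K] DHLin (linearField A) :=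
  quotientComapEquiv (linearFieldHom K n)
    (fun M => ⟨infDefs_eq_top (linearField A) ▸ Submodule.mem_top, M, rfl⟩)
    (comap_linearFieldHom_trivialDefs_inf_linearFields hA)
    (inf_le_right.trans (linearFields_eq_range.le.trans le_sup_left))

/-- The deformation cohomology of a field with non-resonant linear part `A`, presented as the
cokernel of `ad A`. -/
def dhEquiv (hX : X ∈ orderGEFields K n 1) (hres : NonResonant (linearMatrix X)) :
    (Matrix (Fin n) (Fin n) K ⧸ (intertwining K (linearMatrix X) (linearMatrix X)).range) ≃ₗ[K]
      DH X :=
  quotientComapEquiv (linearFieldHom K n) (fun _ => infDefs_eq_top X ▸ Submodule.mem_top)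
    (comap_linearFieldHom_trivialDefs hX hres)
    (le_top.trans (range_linearFieldHom_sup_trivialDefs hX hres).ge)

/-- The deformation cohomology of the foliation of a field with non-resonant linear part `A`,
presented as the cokernel of `ad A` modulo the class of `A`. -/
def dhFolEquiv (hX : X ∈ orderGEFields K n 1) (hres : NonResonant (linearMatrix X)) :
    (Matrix (Fin n) (Fin n) K ⧸ (intertwining K (linearMatrix X) (linearMatrix X)).range ⊔
      Submodule.span K {linearMatrix X}) ≃ₗ[K] DHFol X :=
  quotientComapEquiv (linearFieldHom K n) (fun _ => infDefs_eq_top X ▸ Submodule.mem_top)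
    (comap_linearFieldHom_trivialFolDefs hX hres)
    (le_top.trans <| (range_linearFieldHom_sup_trivialDefs hX hres).ge.trans <|
      sup_le_sup_left (trivialDefs_le_trivialFolDefs X) _)

theorem exists_linearEquiv_DHLin_DH (hX : X ∈ orderGEFields K n 1)
    (hres : NonResonant (linearMatrix X)) :
    ∃ e : DHLin (linearPart X) ≃ₗ[K] DH X, ∀ (Y : VF K n)
      (hY : Y ∈ infDefs (linearPart X) ⊓ linearFields K n), ∃ hY' : Y ∈ infDefs X,
        e (Submodule.Quotient.mk ⟨Y, hY⟩) = Submodule.Quotient.mk ⟨Y, hY'⟩ := by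
  refine ⟨(dhLinEquiv hres).symm.trans (dhEquiv hX hres), ?_⟩
  rintro _ ⟨hY, M, rfl⟩
  refine ⟨infDefs_eq_top X ▸ Submodule.mem_top, ?_⟩
  exact congrArg (dhEquiv hX hres) ((dhLinEquiv hres).symm_apply_apply (Submodule.Quotient.mk M))

lemma finrank_DHLin {A : Matrix (Fin n) (Fin n) K} (hA : NonResonant A) :
    Module.finrank K (DHLin (linearField A)) = Module.finrank K (intertwining K A A).ker := by
  rw [← (dhLinEquiv hA).finrank_eq, ← Nat.add_right_cancel_iff,
    Submodule.finrank_quotient_add_finrank, add_comm, LinearMap.finrank_range_add_finrank_ker]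

lemma finrank_DHFol_add_one (hn : n ≠ 0) (hX : X ∈ orderGEFields K n 1)
    (hres : NonResonant (linearMatrix X)) :
    Module.finrank K (DHFol X) + 1 = Module.finrank K (DHLin (linearPart X)) := by
  rw [← (dhFolEquiv hX hres).finrank_eq, linearPart, ← (dhLinEquiv hres).finrank_eq,
    ← Nat.add_right_cancel_iff, Submodule.finrank_quotient_add_finrank, add_right_comm, add_assoc,
    ← Submodule.finrank_sup_span_singleton (notMem_range_intertwining hn hres.isUnit_det),
    Submodule.finrank_quotient_add_finrank]

end Cohomology

end

end DefCoh

theorem mainTheorem7 {K : Type*} [RCLike K] (n : ℕ) (hn : 1 ≤ n) (X : DefCoh.VF K n)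
    (hX : ∀ j, MvPowerSeries.constantCoeff (X j) = 0)
    (hres : DefCoh.NonResonant (DefCoh.linearMatrix X)) :
    (∃ e : DefCoh.DHLin (DefCoh.linearPart X) ≃ₗ[K] DefCoh.DH X,
      ∀ (Y : DefCoh.VF K n)
        (hY : Y ∈ DefCoh.infDefs (DefCoh.linearPart X) ⊓ DefCoh.linearFields K n),
        ∃ hY' : Y ∈ DefCoh.infDefs X,
          e (Submodule.Quotient.mk ⟨Y, hY⟩) = Submodule.Quotient.mk ⟨Y, hY'⟩) ∧
    Module.Finite K (DefCoh.DHLin (DefCoh.linearPart X)) ∧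
    Module.Finite K (DefCoh.DHFol X) ∧
    (Module.finrank K (DefCoh.DHFol X) : ℤ) =
      (Module.finrank K (DefCoh.DHLin (DefCoh.linearPart X)) : ℤ) - 1 ∧
    (∃ d : ℕ, DefCoh.AdjointOrbitHasDim (DefCoh.linearMatrix X) d ∧
      (Module.finrank K (DefCoh.DHLin (DefCoh.linearPart X)) : ℤ) = (n : ℤ) ^ 2 - (d : ℤ)) ∧
    n ≤ Module.finrank K (DefCoh.DHLin (DefCoh.linearPart X)) ∧
    ((DefCoh.eigenvalues (DefCoh.linearMatrix X)).Nodup →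
      Module.finrank K (DefCoh.DHLin (DefCoh.linearPart X)) = n) := by
  set A := DefCoh.linearMatrix X
  have hX₁ : X ∈ DefCoh.orderGEFields K n 1 := DefCoh.mem_orderGEFields_one_iff.2 hX
  have hLin : Module.finrank K (DefCoh.DHLin (DefCoh.linearPart X)) =
      Module.finrank K (DefCoh.intertwining K A A).ker := DefCoh.finrank_DHLin hres
  have hFol := DefCoh.finrank_DHFol_add_one (Nat.one_le_iff_ne_zero.1 hn) hX₁ hres
  have hrank : Module.finrank K (DefCoh.intertwining K A A).range +
      Module.finrank K (DefCoh.intertwining K A A).ker = n ^ 2 := by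
    simp [LinearMap.finrank_range_add_finrank_ker, Module.finrank_matrix, sq]
  refine ⟨DefCoh.exists_linearEquiv_DHLin_DH hX₁ hres,
    Module.Finite.equiv (DefCoh.dhLinEquiv hres), Module.Finite.equiv (DefCoh.dhFolEquiv hX₁ hres),
    by omega, ⟨_, DefCoh.adjointOrbitHasDim A, ?_⟩, ?_, fun hnodup => ?_⟩
  · rw [hLin, eq_sub_iff_add_eq']
    exact_mod_cast hrank
  · exact hLin ▸ DefCoh.le_finrank_ker_intertwining A
  · exact hLin.trans (DefCoh.finrank_ker_intertwining_of_nodup hnodup)
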